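/- Let $N,p\ge 1$ be integers. In $\mathfrak{gl}(p)$ over $\mathbb C$ put $e_-=\sum_{k=1}^{p-1}E_{k+1,k}$, $M_{j,j}=\sum_{k=1}^{p-j}\frac{(k+j-1)!\,(p-k)!}{(k-1)!\,(p-k-j)!}E_{k,k+j}$ and $M_{j,m-1}=[e_-,M_{j,m}]$ for $0\le j\le p-1$, $-j<m\le j$. Write the generic $Np\times Np$ matrix as $\mathbb J=\sum_{a,b=1}^N\sum_{j=0}^{p-1}\sum_{m=-j}^{j}J^{ab}_{jm}\,E_{ab}\otimes M_{j,m}$ and equip the polynomials in its entries with the Poisson bracket of $\mathfrak{gl}(Np)$, $\{x_{AB},x_{CD}\}=\delta_{BC}x_{AD}-\delta_{AD}x_{CB}$, equivalently $\{\mathrm{tr}(\lambda\mathbb J),\mathbb J\}=[\lambda,\mathbb J]$. The classical algebra $\mathcal W_p(N)=\mathcal W[gl(Np),N.sl(p)]$ is the polynomial algebra $\mathbb C[W^{ab}_j:\ 0\le j<p,\ 1\le a,b\le N]$ with the Poisson bracket, extended as a biderivation from the generators, $\{W_j^{ab},W_\ell^{cd}\}=\{J^{ab}_{jj},J^{cd}_{\ell\ell}\}_*$,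 where $\{\cdot,\cdot\}_*$ is the Dirac bracket for the constraints which fix all $J^{ab}_{jm}$ with $m<j$ to their values at $\mathbb J=1_N\otimes e_-$, that is, for $$\mathbb J|_{g.f.}=1_N\otimes e_-+\sum_{a,b}\sum_{j=0}^{p-1}W_j^{ab}\,E_{ab}\otimes M_{j,j}.$$ Let $W_j$ be the $N\times N$ matrix $(W_j^{ab})$, with $W_j=0$ for $j\ge p$. Then there exist two families of elements $\{{}^{\pm}\bar W_j^{ab}\}_{j\ge 0,\ 1\le a,b\le N}$ of $\mathcal W_p(N)$ such that, for either sign: 1. $\bar W_0\equiv{}^{\pm}\bar W_0=p\,W_0$ and ${}^{\pm}\bar W_1=\pm\frac{p(p^2-1)}{6}\,W_1+\frac{p(p\pm1)}{2}\,W_0W_0$. 2. For some complex numbers ${}^{\pm}\alpha^{n,j}_{\vec s}$ and all $j\ge 0$, $${}^{\pm}\bar W_j^{ab}=\sum_{n=1}^{j+1}\ \sum_{|\vec s|=j+1-n}{}^{\pm}\alpha^{n,j}_{\vec s}\,(W_{s_1}\cdots W_{s_n})^{ab},$$ where $\vec s=(s_1,\dots,s_n)$ runs over the $n$-tuples of non-negative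 integers with $|\vec s|=s_1+\dots+s_n=j+1-n$. In particular ${}^{\pm}\bar W_j^{ab}$ is a polynomial of degree at most $j+1$ in the generators $W_s^{cd}$; the degree of ${}^{+}\bar W_j^{ab}$ is exactly $j+1$ for all $j$, and that of ${}^{-}\bar W_j^{ab}$ is exactly $j+1$ for all $j<p$. 3. For all $a,b,c,d\in\{1,\dots,N\}$ and all $j\ge 0$, $$\{\bar W_0^{ab},{}^{\pm}\bar W_j^{cd}\}=\delta^{cb}\,{}^{\pm}\bar W_j^{ad}-\delta^{ad}\,{}^{\pm}\bar W_j^{cb},$$ $$\{{}^{\pm}\bar W_1^{ab},{}^{\pm}\bar W_j^{cd}\}=\delta^{cb}\,{}^{\pm}\bar W_{j+1}^{ad}-\delta^{ad}\,{}^{\pm}\bar W_{j+1}^{cb}+\bar W_0^{cb}\,{}^{\pm}\bar W_j^{ad}-{}^{\pm}\bar W_j^{cb}\,\bar W_0^{ad}.$$ 4. The elements ${}^{\pm}\bar W_j^{ab}$ with $0\le j<p$ and $1\le a,b\le N$ form a basis of generators of $\mathcal W_p(N)$: they are algebraically independent and generate $\mathcal W_p(N)$ as an algebra. The other ${}^{\pm}\bar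 W_j^{ab}$, $j\ge p$, are polynomials in them. -/

import Mathlib

/-!
Write `p = q + 1`, let `G` be the gauge-fixed matrix and let `T_k` be the lower left `N × N` block
of `G ^ (q + k)`, so that `T_0 = 1`; the families are `⁺W̄_j = T_{j+1}` and the coefficient
`⁻W̄_j` of `x^{j+1}` in the inverse of the power series `∑ (-1)^k T_k x^k`.

Every entry of the lower left block of a power of the generic matrix Poisson commutes with the
constraints `(j, m, a, b)` with `m < 0`. The matrix of constraint brackets is triangular once its
columns are relabelled by `(j, m, a, b) ↦ (j, -1 - m, b, a)`, and its inverse vanishes where both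
indices have `m ≥ 0`. Hence the correction terms of the Dirac bracket vanish on these blocks, and
the bracket of two powers gives
`{T_n^{ab}, T_m^{cd}} = ∑_{i < n} (T_i^{cb} T_{m+n-1-i}^{ad} - T_{m+n-1-i}^{cb} T_i^{ad})`.
Both relations of the first family are the cases `n = 1, 2`; a derivation carries them over to the
inverse series.

Modulo products of at least two generators, `W̄_j` is a nonzero multiple of `W_j`, so the first `p`
matrices generate; `N ^ 2 p` generators of a polynomial algebra in `N ^ 2 p` variables are
algebraically independent. For the degree, send all entries of `W_0` to `X` and the other `W_s` to
`0`: then `T_k` and the coefficients of the second family become multiples of the `k`-th power of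
one matrix by `(q + k).choose k` and `(q + 1).choose k`.
-/

open scoped Kronecker

namespace FiniteW

/-- The biderivation of a polynomial ring with prescribed values `π i k` on the pairs
`(X i, X k)` of variables: `{f, g} = ∑ ∂f/∂X_i * ∂g/∂X_k * π i k`. -/
noncomputable def biderivation {σ : Type} [Fintype σ]
    (π : σ → σ → MvPolynomial σ ℂ) (f g : MvPolynomial σ ℂ) : MvPolynomial σ ℂ :=
  ∑ i, ∑ k, MvPolynomial.pderiv i f * MvPolynomial.pderiv k g * π i k

/-! ### The principal `sl(2)` in `gl(p)`; rows and columns are numbered from `0` -/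

/-- `e₋ = ∑ E_{k+1,k}`. -/
def eMinus (p : ℕ) : Matrix (Fin p) (Fin p) ℂ :=
  Matrix.of fun k l => if (k : ℕ) = l + 1 then 1 else 0

/-- The highest weight matrix `M_{j,j} = ∑ a_k E_{k,k+j}`; with `k` counted from `1`,
`a_k = (k+j-1)! (p-k)! / ((k-1)! (p-k-j)!)`. -/
noncomputable def highest (p j : ℕ) : Matrix (Fin p) (Fin p) ℂ :=
  Matrix.of fun k l =>
    if (l : ℕ) = k + j then
      ((Nat.factorial (k + j) : ℂ) * Nat.factorial (p - 1 - k)) /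
        (Nat.factorial k * Nat.factorial (p - 1 - k - j))
    else 0

/-- `M_{j,m}`, for `-j ≤ m ≤ j`, given by `M_{j,m-1} = [e₋, M_{j,m}]` from `M_{j,j}`. -/
noncomputable def multiplet (p j : ℕ) (m : ℤ) : Matrix (Fin p) (Fin p) ℂ :=
  (fun A => eMinus p * A - A * eMinus p)^[((j : ℤ) - m).toNat] (highest p j)

/-- `M^{jm}_{ab} = E_{ab} ⊗ M_{j,m}`. -/
noncomputable def glBasis (N p j : ℕ) (m : ℤ) (a b : Fin N) :
    Matrix (Fin N × Fin p) (Fin N × Fin p) ℂ :=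
  Matrix.single a b (1 : ℂ) ⊗ₖ multiplet p j m

/-! ### Polynomial functions on `gl(Np)` -/

/-- Polynomials in the entries of an `Np × Np` matrix. -/
abbrev Amb (N p : ℕ) : Type :=
  MvPolynomial ((Fin N × Fin p) × (Fin N × Fin p)) ℂ

/-- The generic matrix `𝕁` of the generators of `gl(Np)`. -/
noncomputable def genericMatrix (N p : ℕ) :
    Matrix (Fin N × Fin p) (Fin N × Fin p) (Amb N p) :=
  Matrix.of fun A B => MvPolynomial.X (A, B)

/-- The Poisson bracket of `gl(Np)`, i.e. `{tr(λ𝕁), 𝕁} = [λ, 𝕁]`; on the entries,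
`{x_{AB}, x_{CD}} = δ_{BC} x_{AD} - δ_{AD} x_{CB}`. -/
noncomputable def glBracket (N p : ℕ) : Amb N p → Amb N p → Amb N p :=
  biderivation fun x y =>
    (if x.2 = y.1 then genericMatrix N p x.1 y.2 else 0) -
      (if x.1 = y.2 then genericMatrix N p y.1 x.2 else 0)

/-- The coordinate `J^{ab}_{jm}` in `𝕁 = ∑ J^{ab}_{jm} M^{jm}_{ab}`, extracted with the trace form,
for which `M^{jm}_{ab}` pairs nontrivially with `M^{j,-m}_{ba}` only. -/
noncomputable def coord (N p j : ℕ) (m : ℤ) (a b : Fin N) : Amb N p :=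
  MvPolynomial.C ((multiplet p j m * multiplet p j (-m)).trace)⁻¹ *
    ((glBasis N p j (-m) b a).map MvPolynomial.C * genericMatrix N p).trace

/-! ### The highest weight gauge, the Dirac bracket and the algebra `W_p(N)` -/

/-- The polynomial algebra underlying the classical `W_p(N)`; the variable `(j, a, b)`
is the generator `W_j^{ab}`, `0 ≤ j < p`. -/
abbrev WAlgebra (N p : ℕ) : Type := MvPolynomial (Fin p × Fin N × Fin N) ℂ

/-- The matrix `W_j = (W_j^{ab})`, with `W_j = 0` for `j ≥ p` (as `M_{j,j} = 0` then). -/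
noncomputable def W (N p j : ℕ) : Matrix (Fin N) (Fin N) (WAlgebra N p) :=
  Matrix.of fun a b => if h : j < p then MvPolynomial.X (⟨j, h⟩, a, b) else 0

/-- `ε₋ = 1 ⊗ e₋`. -/
def epsMinus (N p : ℕ) : Matrix (Fin N × Fin p) (Fin N × Fin p) ℂ :=
  (1 : Matrix (Fin N) (Fin N) ℂ) ⊗ₖ eMinus p

/-- The gauge fixed matrix `ε₋ + ∑ W_j^{ab} M^{jj}_{ab}`. -/
noncomputable def gaugeFixed (N p : ℕ) :
    Matrix (Fin N × Fin p) (Fin N × Fin p) (WAlgebra N p) :=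
  (epsMinus N p).map MvPolynomial.C +
    ∑ j : Fin p, ∑ a : Fin N, ∑ b : Fin N,
      W N p j a b • (glBasis N p j (j : ℕ) a b).map MvPolynomial.C

/-- Imposing all constraints: restriction of a polynomial to the gauge fixed matrices. -/
noncomputable def impose (N p : ℕ) : Amb N p →ₐ[ℂ] WAlgebra N p :=
  MvPolynomial.aeval fun x => gaugeFixed N p x.1 x.2

/-- Labels `(j, m, a, b)` with `0 ≤ j < p` and `-j ≤ m < j` of the constraints. -/
abbrev ConstraintIndex (N p : ℕ) : Type :=
  ((j : Fin p) × Finset.Ico (-((j : ℕ) : ℤ)) ((j : ℕ) : ℤ)) × Fin N × Fin N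

/-- The constraint `φ = J^{ab}_{jm} - (its value at ε₋)`, for `m < j`. -/
noncomputable def constraint (N p : ℕ) (α : ConstraintIndex N p) : Amb N p :=
  coord N p α.1.1 α.1.2 α.2.1 α.2.2 -
    MvPolynomial.C (MvPolynomial.eval (fun x => epsMinus N p x.1 x.2)
      (coord N p α.1.1 α.1.2 α.2.1 α.2.2))

/-- `Δ_{αβ} = {φ_α, φ_β}`, with the constraints imposed afterwards. -/
noncomputable def diracMatrix (N p : ℕ) :
    Matrix (ConstraintIndex N p) (ConstraintIndex N p) (WAlgebra N p) :=
  Matrix.of fun α β => impose N p (glBracket N p (constraint N p α) (constraint N p β))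

/-- The Dirac bracket `{f, g}_* = {f, g} - ∑ {f, φ_α} (Δ⁻¹)_{αβ} {φ_β, g}`, with the constraints
imposed afterwards. -/
noncomputable def diracBracket (N p : ℕ) (f g : Amb N p) : WAlgebra N p :=
  impose N p (glBracket N p f g) -
    ∑ α, ∑ β, impose N p (glBracket N p f (constraint N p α)) * (diracMatrix N p)⁻¹ α β *
      impose N p (glBracket N p (constraint N p β) g)

/-- The Poisson bracket of `W_p(N)`: the biderivation with
`{W_j^{ab}, W_l^{cd}} = {J^{ab}_{jj}, J^{cd}_{ll}}_*`. -/
noncomputable def wBracket (N p : ℕ) : WAlgebra N p → WAlgebra N p → WAlgebra N p :=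
  biderivation fun x y =>
    diracBracket N p (coord N p x.1 (x.1 : ℕ) x.2.1 x.2.2) (coord N p y.1 (y.1 : ℕ) y.2.1 y.2.2)

/-- The Kronecker delta. -/
noncomputable def delta (N p : ℕ) (a b : Fin N) : WAlgebra N p := if a = b then 1 else 0

end FiniteW

namespace FiniteW

open Matrix

/-! ### Leibniz maps -/

section Leibniz

variable {R : Type*} [Ring R]

/-- An additive endomorphism of a possibly noncommutative ring satisfying the Leibniz rule
(Mathlib's `Derivation` requires a commutative domain). -/
def IsLeibniz (δ : R →+ R) : Prop :=
  ∀ x y, δ (x * y) = δ x * y + x * δ y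

theorem lie_mul_eq_add (e x y : R) : ⁅e, x * y⁆ = ⁅e, x⁆ * y + x * ⁅e, y⁆ := by
  simp only [Ring.lie_def]
  noncomm_ring

namespace IsLeibniz

variable {δ : R →+ R} {x y : R}

theorem map_one (hδ : IsLeibniz δ) : δ 1 = 0 := by
  simpa using hδ 1 1

theorem map_pow (hδ : IsLeibniz δ) (x : R) (n : ℕ) :
    δ (x ^ n) = ∑ i ∈ Finset.range n, x ^ i * δ x * x ^ (n - 1 - i) := by
  induction n with
  | zero => simp [hδ.map_one]
  | succ n ih =>
    rw [pow_succ, hδ, ih, Finset.sum_range_succ, Finset.sum_mul]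
    congr 1
    · refine Finset.sum_congr rfl fun i hi => ?_
      have : n + 1 - 1 - i = (n - 1 - i) + 1 := by have := Finset.mem_range.mp hi; omega
      rw [this, pow_succ, mul_assoc]
    · simp

theorem map_pow_of_eq_lie (hδ : IsLeibniz δ) {e : R} (h : δ x = ⁅e, x⁆) (n : ℕ) :
    δ (x ^ n) = ⁅e, x ^ n⁆ := by
  induction n with
  | zero => simp [hδ.map_one, Ring.lie_def]
  | succ n ih => rw [pow_succ, hδ, ih, h, lie_mul_eq_add]

theorem map_of_mul_eq_one (hδ : IsLeibniz δ) (hxy : x * y = 1) (hyx : y * x = 1) :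
    δ y = -(y * δ x * y) := by
  have h : δ x * y + x * δ y = 0 := by rw [← hδ, hxy, hδ.map_one]
  linear_combination (norm := noncomm_ring) y * h - hyx * δ y

theorem map_inverse_of_eq_lie (hδ : IsLeibniz δ) (hxy : x * y = 1) (hyx : y * x = 1) {e : R}
    (h : δ x = ⁅e, x⁆) : δ y = ⁅e, y⁆ := by
  rw [hδ.map_of_mul_eq_one hxy hyx, h, Ring.lie_def, Ring.lie_def]
  linear_combination (norm := noncomm_ring) hyx * e * y - y * e * hxy

theorem map_inverse_of_mul_eq (hδ : IsLeibniz δ) (hxy : x * y = 1) (hyx : y * x = 1) {z e s : R}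
    (hz : ∀ r, Commute r z)
    (h : z * δ x = e * (z * (s * x) - 1 + x) - (z * (x * s) - 1 + x) * e) :
    z * δ y = z * (s * e * y - y * e * s) + ⁅e, y⁆ := by
  have hzy : z * δ y = -(y * (z * δ x) * y) := by
    rw [hδ.map_of_mul_eq_one hxy hyx]
    linear_combination (norm := noncomm_ring) (hz y).eq * δ x * y
  rw [hzy, h, Ring.lie_def]
  linear_combination (norm := noncomm_ring)
    hyx * e * y - y * e * hxy - y * e * z * s * hxy + z * hyx * s * e * y +
      (hz y).eq * x * s * e * y - (hz (y * e)).eq * s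

end IsLeibniz

/-- The entrywise action of a derivation on square matrices. -/
def entrywise {k A n : Type*} [CommSemiring k] [CommRing A] [Algebra k A]
    (D : Derivation k A A) : Matrix n n A →+ Matrix n n A :=
  (D : A →ₗ[k] A).toAddMonoidHom.mapMatrix

theorem entrywise_apply {k A n : Type*} [CommSemiring k] [CommRing A] [Algebra k A]
    (D : Derivation k A A) (M : Matrix n n A) (i j : n) : entrywise D M i j = D (M i j) := rfl

theorem isLeibniz_entrywise {k A n : Type*} [CommSemiring k] [CommRing A] [Algebra k A]
    [Fintype n] [DecidableEq n] (D : Derivation k A A) :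
    IsLeibniz (entrywise D : Matrix n n A →+ Matrix n n A) := fun M M' => by
  ext i j
  have hij (k : n) : D (M i k * M' k j) = D (M i k) * M' k j + M i k * D (M' k j) := by
    rw [D.leibniz, smul_eq_mul, smul_eq_mul, add_comm, mul_comm (M' k j)]
  simp only [entrywise_apply, Matrix.add_apply, mul_apply, map_sum, hij, Finset.sum_add_distrib]

end Leibniz

/-! ### Alternating inverse of a power series -/

section AltInverse

open PowerSeries (coeff coeff_mk)

variable {R S : Type*} [Ring R] [Ring S]

/-- The coefficientwise action of an additive map on power series. -/
noncomputable def coeffwise (δ : R →+ R) : PowerSeries R →+ PowerSeries R where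
  toFun f := PowerSeries.mk fun k => δ (coeff k f)
  map_zero' := by ext; simp
  map_add' f g := by ext; simp

theorem coeff_coeffwise (δ : R →+ R) (f : PowerSeries R) (k : ℕ) :
    coeff k (coeffwise δ f) = δ (coeff k f) := by
  simp [coeffwise]

theorem isLeibniz_coeffwise {δ : R →+ R} (hδ : IsLeibniz δ) : IsLeibniz (coeffwise δ) :=
  fun f g => by
    ext n
    simp only [coeff_coeffwise, PowerSeries.coeff_mul, map_sum, map_add, hδ _ _,
      Finset.sum_add_distrib]

/-- The series `∑ (-1)^k t_k x^k`. -/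
noncomputable def altSeries (t : ℕ → R) : PowerSeries R :=
  PowerSeries.mk fun k => (-1 : ℤ) ^ k • t k

/-- The inverse of `∑ (-1)^k t_k x^k`, for sequences with `t_0 = 1`. -/
noncomputable def altInverseSeries (t : ℕ → R) : PowerSeries R :=
  PowerSeries.invOfUnit (altSeries t) 1

/-- The coefficients of the inverse of `∑ (-1)^k t_k x^k`, for sequences with `t_0 = 1`. If `t_k`
are the elementary symmetric functions of commuting variables, these are the complete ones. -/
noncomputable def altInverse (t : ℕ → R) (k : ℕ) : R :=
  coeff k (altInverseSeries t)

theorem coeff_altSeries (t : ℕ → R) (k : ℕ) : coeff k (altSeries t) = (-1 : ℤ) ^ k • t k :=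
  coeff_mk _ _

theorem altInverse_zero (t : ℕ → R) : altInverse t 0 = 1 := by
  simp [altInverse, altInverseSeries]

variable {t : ℕ → R}

theorem altSeries_mul_altInverseSeries (ht : t 0 = 1) :
    altSeries t * altInverseSeries t = 1 :=
  PowerSeries.mul_invOfUnit _ _ (by simp [altSeries, ht])

theorem altInverseSeries_mul_altSeries (ht : t 0 = 1) :
    altInverseSeries t * altSeries t = 1 :=
  PowerSeries.invOfUnit_mul _ _ (by simp [altSeries, ht])

theorem altInverse_succ (ht : t 0 = 1) (n : ℕ) :
    altInverse t (n + 1) = ∑ x ∈ Finset.HasAntidiagonal.antidiagonal n,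
      (-1 : ℤ) ^ x.1 • (t (x.1 + 1) * altInverse t x.2) := by
  have h := congrArg (coeff (n + 1)) (altSeries_mul_altInverseSeries ht)
  rw [PowerSeries.coeff_mul, Finset.Nat.sum_antidiagonal_succ, PowerSeries.coeff_one,
    if_neg n.succ_ne_zero, coeff_altSeries, pow_zero, one_smul, ht, one_mul] at h
  rw [altInverse, eq_neg_of_add_eq_zero_left h, ← Finset.sum_neg_distrib]
  refine Finset.sum_congr rfl fun x _ => ?_
  rw [coeff_altSeries, altInverse, pow_succ, mul_neg_one, neg_smul, neg_mul, neg_neg,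
    smul_mul_assoc]

theorem altInverse_one (ht : t 0 = 1) : altInverse t 1 = t 1 := by
  simp [altInverse_succ ht 0, altInverse_zero]

theorem altInverse_two (ht : t 0 = 1) : altInverse t 2 = t 1 * t 1 - t 2 := by
  rw [altInverse_succ ht 1, Finset.Nat.sum_antidiagonal_succ]
  simp [altInverse_zero, altInverse_one ht, sub_eq_add_neg]

theorem map_altInverse (φ : R →+* S) (ht : t 0 = 1) (k : ℕ) :
    φ (altInverse t k) = altInverse (fun n => φ (t n)) k := by
  have hφ : altSeries (fun n => φ (t n)) = PowerSeries.map φ (altSeries t) := by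
    ext
    simp [coeff_altSeries]
  have h : PowerSeries.map φ (altInverseSeries t) = altInverseSeries fun n => φ (t n) := by
    refine left_inv_eq_right_inv (a := PowerSeries.map φ (altSeries t)) ?_ ?_
    · rw [← map_mul, altInverseSeries_mul_altSeries ht, map_one]
    · rw [← hφ, altSeries_mul_altInverseSeries (by simp [ht])]
  rw [altInverse, altInverse, ← h, PowerSeries.coeff_map]

theorem IsLeibniz.map_altInverse_of_eq_lie {δ : R →+ R} (hδ : IsLeibniz δ) (ht : t 0 = 1) {e : R}
    (h : ∀ k, δ (t k) = ⁅e, t k⁆) (k : ℕ) : δ (altInverse t k) = ⁅e, altInverse t k⁆ := by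
  have hT : coeffwise δ (altSeries t) = ⁅PowerSeries.C e, altSeries t⁆ := by
    ext k
    simp only [coeff_coeffwise, coeff_altSeries, map_zsmul, h, Ring.lie_def, map_sub,
      PowerSeries.coeff_C_mul, PowerSeries.coeff_mul_C, mul_smul_comm, smul_mul_assoc, smul_sub]
  have hQ := congrArg (coeff k) ((isLeibniz_coeffwise hδ).map_inverse_of_eq_lie
    (altSeries_mul_altInverseSeries ht) (altInverseSeries_mul_altSeries ht) hT)
  rwa [coeff_coeffwise, Ring.lie_def, map_sub, PowerSeries.coeff_C_mul,
    PowerSeries.coeff_mul_C] at hQ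

theorem IsLeibniz.map_altInverse_of_eq {δ : R →+ R} (hδ : IsLeibniz δ) (ht : t 0 = 1) {e : R}
    (h : ∀ k, δ (t k) = e * (t 1 * t k - t (k + 1)) - (t k * t 1 - t (k + 1)) * e) (k : ℕ) :
    δ (altInverse t k) =
      ⁅e, altInverse t (k + 1)⁆ + t 1 * e * altInverse t k - altInverse t k * e * t 1 := by
  have hT : PowerSeries.X * coeffwise δ (altSeries t) =
      PowerSeries.C e * (PowerSeries.X * (PowerSeries.C (t 1) * altSeries t) - 1 + altSeries t) -
      (PowerSeries.X * (altSeries t * PowerSeries.C (t 1)) - 1 + altSeries t) *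
        PowerSeries.C e := by
    ext (_ | k)
    · simp [altSeries, ht]
    · simp only [map_sub, map_add, PowerSeries.coeff_C_mul, PowerSeries.coeff_mul_C,
        PowerSeries.coeff_succ_X_mul, PowerSeries.coeff_one, if_neg k.succ_ne_zero,
        coeff_coeffwise, coeff_altSeries, map_zsmul, h, pow_succ, mul_neg_one, neg_smul]
      rcases neg_one_pow_eq_or ℤ k with hk | hk <;> rw [hk] <;> noncomm_ring
  have hQ := congrArg (coeff (k + 1)) ((isLeibniz_coeffwise hδ).map_inverse_of_mul_eq
    (altSeries_mul_altInverseSeries ht) (altInverseSeries_mul_altSeries ht)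
    PowerSeries.commute_X hT)
  simp only [Ring.lie_def, map_sub, map_add, ← map_mul, PowerSeries.coeff_C_mul,
    PowerSeries.coeff_mul_C, PowerSeries.coeff_succ_X_mul, coeff_coeffwise] at hQ
  rw [altInverse, hQ, Ring.lie_def, altInverse]
  abel

theorem altSeries_choose_mul_mk_choose (q : ℕ) :
    altSeries (fun n => ((q + n).choose n : ℤ)) *
      PowerSeries.mk (fun n => ((q + 1).choose n : ℤ)) = 1 := by
  have hpoly : PowerSeries.mk (fun n => ((q + 1).choose n : ℤ)) =
      (1 + PowerSeries.X) ^ (q + 1) := by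
    ext n
    have := Polynomial.coeff_one_add_X_pow ℤ (q + 1) n
    rw [← Polynomial.coeff_coe] at this
    simpa using this.symm
  have hinv : altSeries (fun n => ((q + n).choose n : ℤ)) = PowerSeries.rescale (-1)
      (PowerSeries.mk fun n => ((q + n).choose q : ℤ)) := by
    ext n
    simp [coeff_altSeries, (Nat.choose_symm_add (a := q) (b := n)).symm]
  have hX : (1 + PowerSeries.X : PowerSeries ℤ) =
      PowerSeries.rescale (-1) (1 - PowerSeries.X) := by
    rw [map_sub, map_one, PowerSeries.rescale_neg_one_X, sub_neg_eq_add]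
  rw [hpoly, hinv, hX, ← map_pow, ← map_mul, ← PowerSeries.mk_one_pow_eq_mk_choose_add,
    ← mul_pow, PowerSeries.mk_one_mul_one_sub_eq_one, one_pow, map_one]

theorem altInverse_choose_smul_pow (q : ℕ) (x : R) (k : ℕ) :
    altInverse (fun n => (q + n).choose n • x ^ n) k = (q + 1).choose k • x ^ k := by
  have h : altSeries (fun n => (q + n).choose n • x ^ n) *
      PowerSeries.mk (fun n => (q + 1).choose n • x ^ n) = 1 := by
    ext n
    have hn := congrArg (coeff n) (altSeries_choose_mul_mk_choose q)
    rw [PowerSeries.coeff_mul, PowerSeries.coeff_one] at hn ⊢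
    have hsum := congrArg (fun z : ℤ => z • x ^ n) hn
    simp only [Finset.sum_smul, ite_smul, one_smul, zero_smul] at hsum
    have hone : (if n = 0 then (1 : R) else 0) = if n = 0 then x ^ n else 0 := by
      split_ifs with h <;> simp [h]
    rw [hone, ← hsum]
    refine Finset.sum_congr rfl fun i hi => ?_
    rw [← Finset.HasAntidiagonal.mem_antidiagonal.mp hi, pow_add]
    simp only [coeff_altSeries, coeff_mk, smul_eq_mul, mul_smul, natCast_zsmul, smul_mul_assoc,
      mul_smul_comm, smul_comm ((q + 1).choose i.2)]
  have hinv := left_inv_eq_right_inv (altInverseSeries_mul_altSeries (by simp)) h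
  rw [altInverse, hinv, coeff_mk]

end AltInverse

/-! ### Graded matrices -/

section IsGraded

variable {n R : Type*} {deg : n → ℤ} {d e : ℤ}

/-- A matrix is graded of degree `d` with respect to `deg` if its nonzero entries raise `deg` by
`d` from the row to the column. -/
def IsGraded [Zero R] (deg : n → ℤ) (d : ℤ) (A : Matrix n n R) : Prop :=
  ∀ ⦃i j⦄, A i j ≠ 0 → deg j = deg i + d

namespace IsGraded

theorem sub [AddGroup R] {A B : Matrix n n R} (hA : IsGraded deg d A) (hB : IsGraded deg d B) :
    IsGraded deg d (A - B) := fun i j h => by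
  by_cases hij : A i j = 0
  · exact hB fun hB0 => h (by rw [Matrix.sub_apply, hij, hB0, sub_zero])
  · exact hA hij

variable [Fintype n]

theorem mul [NonUnitalNonAssocSemiring R] {A B : Matrix n n R} (hA : IsGraded deg d A)
    (hB : IsGraded deg e B) : IsGraded deg (d + e) (A * B) := fun i j h => by
  obtain ⟨k, -, hk⟩ := Finset.exists_ne_zero_of_sum_ne_zero h
  rw [hB (right_ne_zero_of_mul hk), hA (left_ne_zero_of_mul hk), add_assoc]

theorem trace_eq_zero [AddCommMonoid R] {A : Matrix n n R} (hA : IsGraded deg d A) (hd : d ≠ 0) :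
    A.trace = 0 :=
  Finset.sum_eq_zero fun _ _ => by_contra fun h => hd (by simpa using hA h)

end IsGraded

end IsGraded

/-! ### The principal `sl(2)` -/

section PrincipalSl2

theorem eMinus_apply (p : ℕ) (k l : Fin p) :
    eMinus p k l = if (k : ℕ) = l + 1 then 1 else 0 := rfl

theorem highest_apply_of_eq {p j : ℕ} {k l : Fin p} (h : (l : ℕ) = k + j) :
    highest p j k l = ((Nat.factorial (k + j) : ℂ) * Nat.factorial (p - 1 - k)) /
        (Nat.factorial k * Nat.factorial (p - 1 - k - j)) := by
  simp [highest, h]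

theorem highest_apply_of_ne {p j : ℕ} {k l : Fin p} (h : (l : ℕ) ≠ k + j) :
    highest p j k l = 0 := by
  simp [highest, h]

theorem eMinus_pow_apply (p n : ℕ) (k l : Fin p) :
    (eMinus p ^ n) k l = if (k : ℕ) = l + n then 1 else 0 := by
  induction n generalizing l with
  | zero => simp [one_apply, Fin.ext_iff]
  | succ n ih =>
    rw [pow_succ, mul_apply]
    simp only [ih, eMinus_apply, mul_ite, mul_one, mul_zero]
    by_cases hl : (l : ℕ) + 1 < p
    · rw [Finset.sum_eq_single ⟨l + 1, hl⟩ (fun m _ hm => if_neg (hm ∘ Fin.ext)) (by simp)]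
      simp [add_assoc, add_comm 1 n]
    · rw [if_neg (by omega)]
      exact Finset.sum_eq_zero fun m _ => if_neg (by omega)

theorem highest_zero (p : ℕ) : highest p 0 = 1 := by
  ext k l
  by_cases h : k = l
  · subst h
    rw [highest_apply_of_eq (by simp)]
    have := Nat.factorial_ne_zero k
    have := Nat.factorial_ne_zero (p - 1 - k)
    simp only [add_zero, Nat.sub_zero, one_apply_eq]
    field_simp
  · rw [highest_apply_of_ne (by simpa [Fin.ext_iff, eq_comm] using h), one_apply_ne h]

theorem highest_one_apply {p : ℕ} {k l : Fin p} (h : (l : ℕ) = k + 1) :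
    highest p 1 k l = ((k : ℂ) + 1) * (p - 1 - k) := by
  rw [highest_apply_of_eq h]
  obtain ⟨r, hr⟩ : ∃ r, p = k + 2 + r := ⟨p - (k + 2), by omega⟩
  have hsub : p - 1 - (k : ℕ) = r + 1 := by omega
  have hcast : (p : ℂ) = k + 2 + r := by exact_mod_cast hr
  rw [hsub, hcast, Nat.add_sub_cancel, Nat.factorial_succ, Nat.factorial_succ]
  have := Nat.factorial_ne_zero k
  have := Nat.factorial_ne_zero r
  push_cast
  field_simp
  ring

theorem highest_succ (p j : ℕ) : highest p (j + 1) = highest p j * highest p 1 := by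
  ext k l
  rw [mul_apply]
  by_cases h : (l : ℕ) = k + (j + 1)
  · rw [Finset.sum_eq_single (⟨k + j, by omega⟩ : Fin p)
      (fun m _ hm => by rw [highest_apply_of_ne (fun h => hm (Fin.ext h)), zero_mul]) (by simp),
      highest_apply_of_eq h, highest_apply_of_eq (by simp), highest_apply_of_eq (by simp; omega)]
    have hpred : p - 1 - (k : ℕ) - (j + 1) = p - 1 - (k + j) - 1 := by omega
    have hsub : p - 1 - (k : ℕ) - j = p - 1 - (k + j) := by omega
    simp only [hpred, hsub, ← add_assoc]
    have := Nat.factorial_ne_zero k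
    have := Nat.factorial_ne_zero (k + j)
    have := Nat.factorial_ne_zero (p - 1 - (k + j))
    have := Nat.factorial_ne_zero (p - 1 - (k + j) - 1)
    field_simp
  · rw [highest_apply_of_ne h, Finset.sum_eq_zero]
    intro m _
    by_cases hm : (m : ℕ) = k + j
    · rw [highest_apply_of_ne (l := l) (by omega), mul_zero]
    · rw [highest_apply_of_ne hm, zero_mul]

theorem eMinus_mul_highest_one (p : ℕ) :
    eMinus p * highest p 1 = diagonal fun k : Fin p => (k : ℂ) * (p - k) := by
  ext k l
  rw [mul_apply, diagonal_apply]
  simp only [eMinus_apply, ite_mul, one_mul, zero_mul]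
  rcases Nat.eq_zero_or_pos (k : ℕ) with hk | hk
  · rw [Finset.sum_eq_zero fun m _ => if_neg (by omega)]
    simp [hk]
  · rw [Finset.sum_eq_single (⟨k - 1, by omega⟩ : Fin p)
      (fun m _ hm => if_neg fun h => hm (Fin.ext (by simp; omega))) (by simp),
      if_pos (by simp; omega)]
    split_ifs with h
    · subst h
      rw [highest_one_apply (by simp; omega)]
      push_cast [Nat.cast_sub hk]
      ring
    · exact highest_apply_of_ne fun h' => h (Fin.ext (by simp at h'; omega))

theorem highest_one_mul_eMinus (p : ℕ) :
    highest p 1 * eMinus p = diagonal fun k : Fin p => ((k : ℂ) + 1) * (p - 1 - k) := by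
  ext k l
  rw [mul_apply, diagonal_apply]
  by_cases hk : (k : ℕ) + 1 < p
  · rw [Finset.sum_eq_single (⟨k + 1, hk⟩ : Fin p)
      (fun m _ hm => by rw [highest_apply_of_ne (fun h => hm (Fin.ext h)), zero_mul]) (by simp),
      highest_one_apply (by simp), eMinus_apply]
    simp [Fin.ext_iff]
  · have hp : (p : ℂ) - 1 - k = 0 := by
      have : (p : ℂ) = k + 1 := by exact_mod_cast (show p = (k : ℕ) + 1 by omega)
      rw [this]
      ring
    rw [hp, mul_zero, ite_self]
    exact Finset.sum_eq_zero fun m _ => by rw [highest_apply_of_ne (by omega), zero_mul]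

/-- The adjoint action `[e₋, ·]`, which lowers the multiplets. -/
noncomputable def adMinus (p : ℕ) : Module.End ℂ (Matrix (Fin p) (Fin p) ℂ) :=
  LinearMap.mulLeft ℂ (eMinus p) - LinearMap.mulRight ℂ (eMinus p)

theorem adMinus_apply (p : ℕ) (A : Matrix (Fin p) (Fin p) ℂ) :
    adMinus p A = eMinus p * A - A * eMinus p := rfl

theorem adMinus_mul (p : ℕ) (A B : Matrix (Fin p) (Fin p) ℂ) :
    adMinus p (A * B) = adMinus p A * B + A * adMinus p B :=
  lie_mul_eq_add (eMinus p) A B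

theorem adMinus_highest_one (p : ℕ) :
    adMinus p (highest p 1) = diagonal fun k : Fin p => 2 * (k : ℂ) - p + 1 := by
  rw [adMinus_apply, eMinus_mul_highest_one, highest_one_mul_eMinus, diagonal_sub]
  congr! 2
  ring

theorem adMinus_adMinus_highest_one (p : ℕ) :
    adMinus p (adMinus p (highest p 1)) = (-2 : ℂ) • eMinus p := by
  rw [adMinus_highest_one]
  ext k l
  rw [adMinus_apply, Matrix.sub_apply, mul_diagonal, diagonal_mul, Matrix.smul_apply,
    eMinus_apply]
  split_ifs with h
  · rw [h, smul_eq_mul]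
    push_cast
    ring
  · simp

theorem adMinus_eMinus (p : ℕ) : adMinus p (eMinus p) = 0 := sub_self _

/-- The Leibniz formula for powers of `adMinus`, which stops at the third term because
`[e₋, [e₋, M_{1,1}]]` is a multiple of `e₋`. -/
theorem adMinus_pow_mul_highest_one (p : ℕ) (A : Matrix (Fin p) (Fin p) ℂ) (n : ℕ) :
    (adMinus p ^ (n + 2)) (A * highest p 1) =
      (adMinus p ^ (n + 2)) A * highest p 1 +
        ((n + 2 : ℕ) : ℂ) • ((adMinus p ^ (n + 1)) A * adMinus p (highest p 1)) -
        ((n + 2 : ℂ) * (n + 1)) • ((adMinus p ^ n) A * eMinus p) := by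
  induction n with
  | zero =>
    simp only [zero_add, pow_succ', pow_zero, Module.End.mul_apply, Module.End.one_apply,
      adMinus_mul, map_add, adMinus_adMinus_highest_one, Matrix.mul_smul]
    push_cast
    module
  | succ n ih =>
    have hlower (k : ℕ) (B) : adMinus p ((adMinus p ^ k) B) = (adMinus p ^ (k + 1)) B := by
      rw [pow_succ', Module.End.mul_apply]
    refine (hlower (n + 2) _).symm.trans ?_
    rw [ih]
    simp only [map_sub, map_add, map_smul, adMinus_mul, adMinus_adMinus_highest_one,
      adMinus_eMinus, Matrix.mul_smul, mul_zero, hlower, add_assoc,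
      Nat.reduceAdd]
    push_cast
    module

theorem adMinus_pow_highest (p l : ℕ) :
    (∃ c : ℂ, c ≠ 0 ∧ (adMinus p ^ (2 * l)) (highest p l) = c • eMinus p ^ l) ∧
      (adMinus p ^ (2 * l + 1)) (highest p l) = 0 := by
  induction l with
  | zero => exact ⟨⟨1, one_ne_zero, by simp [highest_zero]⟩, by simp [highest_zero, adMinus_apply]⟩
  | succ l ih =>
    obtain ⟨⟨c, hc, hlowest⟩, hzero⟩ := ih
    have hzero_succ (n : ℕ) (h : (adMinus p ^ n) (highest p l) = 0) :
        (adMinus p ^ (n + 1)) (highest p l) = 0 := by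
      rw [pow_succ', Module.End.mul_apply, h, map_zero]
    have hzero₂ := hzero_succ _ hzero
    have hzero₃ := hzero_succ _ hzero₂
    constructor
    · refine ⟨-(((2 * l : ℕ) + 2 : ℂ) * ((2 * l : ℕ) + 1) * c), ?_, ?_⟩
      · exact neg_ne_zero.mpr (mul_ne_zero (mul_ne_zero (by norm_cast) (by norm_cast)) hc)
      · rw [mul_add_one, highest_succ, adMinus_pow_mul_highest_one, hlowest, hzero, hzero₂,
          pow_succ, Matrix.smul_mul, smul_smul]
        simp
    · rw [show 2 * (l + 1) + 1 = (2 * l + 1) + 2 by ring, highest_succ,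
        adMinus_pow_mul_highest_one, hzero, hzero₂, hzero₃]
      simp

theorem trace_adMinus_mul (p : ℕ) (A B : Matrix (Fin p) (Fin p) ℂ) :
    (adMinus p A * B).trace = -(A * adMinus p B).trace := by
  rw [eq_neg_iff_add_eq_zero, ← trace_add, ← adMinus_mul, adMinus_apply, trace_sub,
    trace_mul_comm, sub_self]

theorem trace_adMinus_pow_mul (p n : ℕ) (A B : Matrix (Fin p) (Fin p) ℂ) :
    ((adMinus p ^ n) A * B).trace = (-1) ^ n * (A * (adMinus p ^ n) B).trace := by
  induction n generalizing B with
  | zero => simp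
  | succ n ih =>
    rw [pow_succ', Module.End.mul_apply, trace_adMinus_mul, ih, ← pow_succ', pow_succ (adMinus p),
      Module.End.mul_apply]
    ring

section Positivity

open scoped ComplexOrder

theorem highest_pos {p j : ℕ} {k l : Fin p} (h : (l : ℕ) = k + j) : 0 < highest p j k l := by
  rw [highest_apply_of_eq h]
  positivity

theorem highest_nonneg (p j : ℕ) (k l : Fin p) : 0 ≤ highest p j k l := by
  by_cases h : (l : ℕ) = k + j
  · exact (highest_pos h).le
  · exact (highest_apply_of_ne h).ge

theorem eMinus_pow_nonneg (p n : ℕ) (k l : Fin p) : 0 ≤ (eMinus p ^ n) k l := by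
  rw [eMinus_pow_apply]
  split_ifs <;> simp

theorem trace_highest_mul_eMinus_pow_ne_zero {p j : ℕ} (hj : j < p) :
    (highest p j * eMinus p ^ j).trace ≠ 0 := by
  have hterm (k l : Fin p) : 0 ≤ highest p j k l * (eMinus p ^ j) l k :=
    mul_nonneg (highest_nonneg ..) (eMinus_pow_nonneg ..)
  refine (Finset.sum_pos' (fun k _ => Finset.sum_nonneg fun l _ => hterm k l)
    ⟨⟨0, by omega⟩, Finset.mem_univ _, Finset.sum_pos' (fun l _ => hterm _ l)
      ⟨⟨j, hj⟩, Finset.mem_univ _, ?_⟩⟩).ne'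
  rw [eMinus_pow_apply, if_pos (by simp), mul_one]
  exact highest_pos (by simp)

end Positivity

end PrincipalSl2

section Multiplets

theorem multiplet_eq_adMinus_pow (p j : ℕ) (m : ℤ) :
    multiplet p j m = (adMinus p ^ ((j : ℤ) - m).toNat) (highest p j) := by
  rw [Module.End.pow_apply]
  rfl

theorem multiplet_self (p j : ℕ) : multiplet p j j = highest p j := by
  simp [multiplet_eq_adMinus_pow]

theorem adMinus_multiplet {p j : ℕ} {m : ℤ} (hm : m ≤ j) :
    adMinus p (multiplet p j m) = multiplet p j (m - 1) := by
  have hdepth : ((j : ℤ) - (m - 1)).toNat = ((j : ℤ) - m).toNat + 1 := by omega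
  rw [multiplet_eq_adMinus_pow, multiplet_eq_adMinus_pow, hdepth, pow_succ', Module.End.mul_apply]

theorem isGraded_eMinus (p : ℕ) : IsGraded (fun k : Fin p => (k : ℤ)) (-1) (eMinus p) :=
  fun k l h => by
    rw [eMinus_apply] at h
    have := (ite_ne_right_iff.mp h).1
    lia

theorem isGraded_multiplet {p j : ℕ} {m : ℤ} (hm : m ≤ j) :
    IsGraded (fun k : Fin p => (k : ℤ)) m (multiplet p j m) := by
  obtain ⟨r, rfl⟩ : ∃ r : ℕ, m = j - r := ⟨((j : ℤ) - m).toNat, by omega⟩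
  induction r with
  | zero =>
    intro k l h
    rw [Nat.cast_zero, sub_zero, multiplet_self] at h
    have := not_imp_comm.mp highest_apply_of_ne h
    lia
  | succ r ih =>
    have hr : (j : ℤ) - r ≤ j := by omega
    have hright := (ih hr).mul (isGraded_eMinus p)
    have hleft := (isGraded_eMinus p).mul (ih hr)
    rw [add_comm] at hleft
    rw [Nat.cast_succ, ← sub_sub, ← adMinus_multiplet hr, adMinus_apply]
    exact hleft.sub hright

/-- The value `tr(M_{j,m} M_{j,-m})` of the trace form on dual members of a multiplet. -/
noncomputable def pairing (p j : ℕ) (m : ℤ) : ℂ :=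
  (multiplet p j m * multiplet p j (-m)).trace

theorem trace_multiplet_mul (p j l : ℕ) (m n : ℤ) :
    (multiplet p j m * multiplet p l n).trace = (-1) ^ ((j : ℤ) - m).toNat *
      (highest p j * (adMinus p ^ (((j : ℤ) - m).toNat + ((l : ℤ) - n).toNat))
        (highest p l)).trace := by
  rw [multiplet_eq_adMinus_pow, multiplet_eq_adMinus_pow, trace_adMinus_pow_mul, pow_add,
    Module.End.mul_apply]

theorem trace_multiplet_mul_of_add_ne_zero {p j l : ℕ} {m n : ℤ} (hm : m ≤ j) (hn : n ≤ l)
    (h : m + n ≠ 0) : (multiplet p j m * multiplet p l n).trace = 0 :=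
  ((isGraded_multiplet hm).mul (isGraded_multiplet hn)).trace_eq_zero h

theorem trace_multiplet_mul_of_lt {p j l : ℕ} {m n : ℤ} (hm : m ≤ j) (hn : n ≤ l) (h : l < j) :
    (multiplet p j m * multiplet p l n).trace = 0 := by
  by_cases hmn : m + n = 0
  · obtain ⟨r, hr⟩ : ∃ r, ((j : ℤ) - m).toNat + ((l : ℤ) - n).toNat = r + (2 * l + 1) :=
      ⟨((j : ℤ) - m).toNat + ((l : ℤ) - n).toNat - (2 * l + 1), by omega⟩
    rw [trace_multiplet_mul, hr, pow_add, Module.End.mul_apply, (adMinus_pow_highest p l).2,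
      map_zero, mul_zero, trace_zero, mul_zero]
  · exact trace_multiplet_mul_of_add_ne_zero hm hn hmn

theorem trace_multiplet_mul_of_ne {p j l : ℕ} {m n : ℤ} (hm : m ≤ j) (hn : n ≤ l)
    (h : j ≠ l ∨ m + n ≠ 0) : (multiplet p j m * multiplet p l n).trace = 0 := by
  rcases lt_trichotomy l j with hlj | rfl | hlj
  · exact trace_multiplet_mul_of_lt hm hn hlj
  · exact trace_multiplet_mul_of_add_ne_zero hm hn (h.resolve_left (not_not.mpr rfl))
  · rw [trace_mul_comm]
    exact trace_multiplet_mul_of_lt hn hm hlj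

theorem pairing_ne_zero {p j : ℕ} (hj : j < p) {m : ℤ} (hm : m ≤ j) (hm' : -j ≤ m) :
    pairing p j m ≠ 0 := by
  have hdepth : ((j : ℤ) - m).toNat + ((j : ℤ) - -m).toNat = 2 * j := by omega
  obtain ⟨c, hc, hlowest⟩ := (adMinus_pow_highest p j).1
  rw [pairing, trace_multiplet_mul, hdepth, hlowest, Matrix.mul_smul, trace_smul]
  exact mul_ne_zero (pow_ne_zero _ (by norm_num))
    (mul_ne_zero hc (trace_highest_mul_eMinus_pow_ne_zero hj))

/-- Labels `(j, m)` with `0 ≤ j < p` and `-j ≤ m ≤ j` of the basis `M_{j,m}` of `gl(p)`. -/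
abbrev MultipletIndex (p : ℕ) : Type := (j : Fin p) × Finset.Icc (-((j : ℕ) : ℤ)) ((j : ℕ) : ℤ)

theorem card_multipletIndex (p : ℕ) : Fintype.card (MultipletIndex p) = p * p := by
  have hcard (j : Fin p) : Fintype.card (Finset.Icc (-((j : ℕ) : ℤ)) ((j : ℕ) : ℤ)) =
      2 * (j : ℕ) + 1 := by
    rw [Fintype.card_coe, Int.card_Icc]
    omega
  rw [Fintype.card_sigma, Finset.sum_congr rfl fun j _ => hcard j,
    Fin.sum_univ_eq_sum_range fun j => 2 * j + 1]
  induction p with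
  | zero => rfl
  | succ p ih =>
    rw [Finset.sum_range_succ, ih fun j => hcard j.castSucc]
    ring

/-- The basis of `gl(p)` dual to `M_{j,m}` under the trace form. -/
noncomputable def dualMultiplet (p : ℕ) (i : MultipletIndex p) : Matrix (Fin p) (Fin p) ℂ :=
  (pairing p i.1 i.2)⁻¹ • multiplet p i.1 (-i.2)

theorem trace_dualMultiplet_mul_multiplet (p : ℕ) (i i' : MultipletIndex p) :
    (dualMultiplet p i * multiplet p i'.1 i'.2).trace = if i = i' then 1 else 0 := by
  obtain ⟨j, m, hm⟩ := i
  obtain ⟨j', m', hm'⟩ := i'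
  rw [Finset.mem_Icc] at hm hm'
  rw [dualMultiplet, Matrix.smul_mul, trace_smul, smul_eq_mul]
  split_ifs with h
  · obtain ⟨rfl, hmm'⟩ := Sigma.mk.inj h
    obtain rfl : m = m' := congrArg Subtype.val (eq_of_heq hmm')
    rw [trace_mul_comm]
    exact inv_mul_cancel₀ (pairing_ne_zero j.2 hm.2 hm.1)
  · rw [trace_multiplet_mul_of_ne (neg_le.mp hm.1) hm'.2, mul_zero]
    by_contra! hne
    obtain rfl : j = j' := Fin.ext hne.1
    obtain rfl : m = m' := by linarith [hne.2]
    exact h rfl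

theorem eq_sum_trace_mul_smul {ι n R : Type*} [Fintype ι] [DecidableEq ι] [Fintype n]
    [CommRing R] (hcard : Fintype.card ι = Fintype.card n * Fintype.card n)
    {u v : ι → Matrix n n R} (h : ∀ i i', (v i * u i').trace = if i = i' then 1 else 0)
    (A : Matrix n n R) : A = ∑ i, (v i * A).trace • u i := by
  classical
  let U : Matrix (n × n) ι R := of fun x i => u i x.1 x.2
  let V : Matrix ι (n × n) R := of fun i x => v i x.2 x.1
  have hV (i : ι) (B : Matrix n n R) : ∑ x : n × n, V i x * B x.1 x.2 = (v i * B).trace := by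
    rw [Fintype.sum_prod_type, Finset.sum_comm]
    rfl
  have hVU : V * U = 1 := by
    ext i i'
    rw [one_apply, ← h]
    exact hV i (u i')
  have hUV : U * V = 1 :=
    (mul_eq_one_comm_of_card_eq _ _ _ (by rw [hcard, Fintype.card_prod])).mp hVU
  ext k l
  calc A k l = (U *ᵥ V *ᵥ fun x => A x.1 x.2) (k, l) := by
        rw [mulVec_mulVec, hUV, one_mulVec]
    _ = ∑ i, u i k l * (v i * A).trace :=
        Finset.sum_congr rfl fun i _ => congrArg (u i k l * ·) (hV i A)
    _ = (∑ i, (v i * A).trace • u i) k l := by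
        simp only [Matrix.sum_apply, Matrix.smul_apply, smul_eq_mul, mul_comm]

end Multiplets

/-! ### Biderivations and the bracket of `gl(Np)` -/

section Biderivation

theorem derivation_aeval {R σ A M : Type*} [CommSemiring R] [Fintype σ] [CommSemiring A]
    [AddCommMonoid M] [Algebra R A] [Module R M] [Module A M] (D : Derivation R A M) (φ : σ → A)
    (f : MvPolynomial σ R) :
    D (MvPolynomial.aeval φ f) =
      ∑ x, MvPolynomial.aeval φ (MvPolynomial.pderiv x f) • D (φ x) := by
  classical
  induction f using MvPolynomial.induction_on with
  | C a => simp
  | add f g hf hg => simp only [map_add, hf, hg, add_smul, Finset.sum_add_distrib]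
  | mul_X f k hf =>
    simp only [map_mul, Derivation.leibniz, hf, MvPolynomial.aeval_X, smul_eq_mul, map_add,
      add_smul, mul_smul, Finset.sum_add_distrib, Finset.smul_sum, MvPolynomial.pderiv_X]
    congr 1
    rw [Finset.sum_eq_single k (fun x _ hx => by simp [Pi.single_eq_of_ne hx.symm]) (by simp)]
    simp

theorem derivation_eq_sum_pderiv {R σ M : Type*} [CommSemiring R] [Fintype σ] [AddCommMonoid M]
    [Module R M] [Module (MvPolynomial σ R) M] (D : Derivation R (MvPolynomial σ R) M)
    (f : MvPolynomial σ R) : D f = ∑ x, MvPolynomial.pderiv x f • D (MvPolynomial.X x) := by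
  simpa only [MvPolynomial.aeval_X_left_apply] using derivation_aeval D MvPolynomial.X f

variable {σ : Type} [Fintype σ]

/-- The derivation `{f, ·}`, for a bracket which is a derivation in its second argument. -/
noncomputable def hamiltonian (β : MvPolynomial σ ℂ → MvPolynomial σ ℂ → MvPolynomial σ ℂ)
    (f : MvPolynomial σ ℂ) : Derivation ℂ (MvPolynomial σ ℂ) (MvPolynomial σ ℂ) :=
  MvPolynomial.mkDerivation ℂ fun k => β f (MvPolynomial.X k)

variable (π : σ → σ → MvPolynomial σ ℂ)

theorem biderivation_X_right (f : MvPolynomial σ ℂ) (k : σ) :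
    biderivation π f (MvPolynomial.X k) = ∑ i, MvPolynomial.pderiv i f * π i k := by
  classical
  refine Finset.sum_congr rfl fun i _ => ?_
  rw [Finset.sum_eq_single k (fun j _ hj => by
    rw [MvPolynomial.pderiv_X_of_ne hj.symm, mul_zero, zero_mul]) (by simp),
    MvPolynomial.pderiv_X_self, mul_one]

theorem biderivation_eq_sum_right (f g : MvPolynomial σ ℂ) :
    biderivation π f g =
      ∑ k, MvPolynomial.pderiv k g * biderivation π f (MvPolynomial.X k) := by
  simp only [biderivation_X_right, Finset.mul_sum]
  rw [biderivation, Finset.sum_comm]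
  exact Finset.sum_congr rfl fun k _ => Finset.sum_congr rfl fun i _ => by ring

theorem hamiltonian_biderivation (f g : MvPolynomial σ ℂ) :
    hamiltonian (biderivation π) f g = biderivation π f g := by
  rw [derivation_eq_sum_pderiv, biderivation_eq_sum_right]
  simp only [hamiltonian, MvPolynomial.mkDerivation_X, smul_eq_mul]

theorem biderivation_X_X (i k : σ) :
    biderivation π (MvPolynomial.X i) (MvPolynomial.X k) = π i k := by
  classical
  rw [biderivation_X_right, Finset.sum_eq_single i (fun j _ hj => by
    rw [MvPolynomial.pderiv_X_of_ne hj.symm, zero_mul]) (by simp),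
    MvPolynomial.pderiv_X_self, one_mul]

variable {π}

theorem biderivation_antisymm (hπ : ∀ i k, π i k = -π k i) (f g : MvPolynomial σ ℂ) :
    biderivation π f g = -biderivation π g f := by
  rw [biderivation, biderivation, Finset.sum_comm]
  simp only [← Finset.sum_neg_distrib]
  refine Finset.sum_congr rfl fun k _ => Finset.sum_congr rfl fun i _ => ?_
  rw [hπ]
  ring

end Biderivation

section GlBracket

variable {N p : ℕ}

theorem hamiltonian_glBracket (f g : Amb N p) :
    hamiltonian (glBracket N p) f g = glBracket N p f g :=
  hamiltonian_biderivation _ f g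

theorem glBracket_antisymm (f g : Amb N p) : glBracket N p f g = -glBracket N p g f :=
  biderivation_antisymm (fun x y => by simp only [neg_sub, eq_comm]) f g

theorem glBracket_X_X (A B C D : Fin N × Fin p) :
    glBracket N p (MvPolynomial.X (A, B)) (MvPolynomial.X (C, D)) =
      (if B = C then genericMatrix N p A D else 0) -
        (if A = D then genericMatrix N p C B else 0) :=
  biderivation_X_X _ _ _

theorem single_one_mul_apply {n R : Type*} [Fintype n] [DecidableEq n] [Semiring R] (i j k l : n)
    (M : Matrix n n R) : (single i j (1 : R) * M) k l = if i = k then M j l else 0 := by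
  rw [mul_apply, Finset.sum_eq_single j (fun x _ hx => by simp [hx.symm]) (by simp)]
  simp [single_apply]

theorem mul_single_one_apply {n R : Type*} [Fintype n] [DecidableEq n] [Semiring R] (i j k l : n)
    (M : Matrix n n R) : (M * single i j (1 : R)) k l = if j = l then M k i else 0 := by
  rw [mul_apply, Finset.sum_eq_single i (fun x _ hx => by simp [hx.symm]) (by simp)]
  simp [single_apply]

/-- The linear function `tr(Λ 𝕁)` on `gl(Np)`. -/
noncomputable def traceForm (Λ : Matrix (Fin N × Fin p) (Fin N × Fin p) ℂ) : Amb N p :=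
  (Λ.map MvPolynomial.C * genericMatrix N p).trace

theorem traceForm_eq_sum (Λ : Matrix (Fin N × Fin p) (Fin N × Fin p) ℂ) :
    traceForm Λ = ∑ A, ∑ B, Λ A B • MvPolynomial.X (B, A) := by
  simp only [MvPolynomial.smul_eq_C_mul]
  rfl

theorem traceForm_smul (c : ℂ) (Λ : Matrix (Fin N × Fin p) (Fin N × Fin p) ℂ) :
    traceForm (c • Λ) = c • traceForm Λ := by
  simp only [traceForm_eq_sum, Matrix.smul_apply, smul_eq_mul, mul_smul, Finset.smul_sum]

theorem coord_eq_smul_traceForm (j : ℕ) (m : ℤ) (a b : Fin N) :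
    coord N p j m a b = (pairing p j m)⁻¹ • traceForm (glBasis N p j (-m) b a) :=
  (MvPolynomial.smul_eq_C_mul _ _).symm

theorem traceForm_single (A B : Fin N × Fin p) :
    traceForm (single B A 1) = MvPolynomial.X (A, B) := by
  rw [traceForm, map_single, map_one, trace_single_mul, one_smul]
  rfl

theorem entrywise_hamiltonian_traceForm (Λ : Matrix (Fin N × Fin p) (Fin N × Fin p) ℂ) :
    entrywise (hamiltonian (glBracket N p) (traceForm Λ)) (genericMatrix N p) =
      ⁅(Λ.map MvPolynomial.C : Matrix _ _ (Amb N p)), genericMatrix N p⁆ := by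
  refine Matrix.ext fun C D => ?_
  have h : glBracket N p (MvPolynomial.X (C, D)) (traceForm Λ) =
      ∑ A, Λ A D • genericMatrix N p C A - ∑ B, Λ C B • genericMatrix N p B D := by
    rw [← hamiltonian_glBracket, traceForm_eq_sum]
    simp only [map_sum, Derivation.map_smul, hamiltonian_glBracket, glBracket_X_X, smul_sub,
      Finset.sum_sub_distrib, smul_ite, smul_zero, Finset.sum_ite_eq, Finset.mem_univ, if_true]
    rw [Finset.sum_comm]
    simp only [Finset.sum_ite_eq, Finset.mem_univ, if_true]
  calc hamiltonian (glBracket N p) (traceForm Λ) (MvPolynomial.X (C, D))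
      = ∑ B, Λ C B • genericMatrix N p B D - ∑ A, Λ A D • genericMatrix N p C A := by
        rw [hamiltonian_glBracket, glBracket_antisymm, h, neg_sub]
    _ = ⁅(Λ.map MvPolynomial.C : Matrix _ _ (Amb N p)), genericMatrix N p⁆ C D := by
        simp only [Ring.lie_def, Matrix.sub_apply, mul_apply, map_apply,
          MvPolynomial.smul_eq_C_mul, mul_comm (MvPolynomial.C (Λ _ D))]

theorem entrywise_hamiltonian_traceForm_pow (Λ : Matrix (Fin N × Fin p) (Fin N × Fin p) ℂ)
    (n : ℕ) : entrywise (hamiltonian (glBracket N p) (traceForm Λ)) (genericMatrix N p ^ n) =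
      ⁅(Λ.map MvPolynomial.C : Matrix _ _ (Amb N p)), genericMatrix N p ^ n⁆ :=
  (isLeibniz_entrywise _).map_pow_of_eq_lie (entrywise_hamiltonian_traceForm Λ) n

theorem glBracket_traceForm_traceForm (Λ M : Matrix (Fin N × Fin p) (Fin N × Fin p) ℂ) :
    glBracket N p (traceForm Λ) (traceForm M) = traceForm (M * Λ) - traceForm (Λ * M) := by
  have hM : hamiltonian (glBracket N p) (traceForm Λ) (traceForm M) =
      (M.map MvPolynomial.C *
        entrywise (hamiltonian (glBracket N p) (traceForm Λ)) (genericMatrix N p)).trace := by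
    have hleibniz := (isLeibniz_entrywise (hamiltonian (glBracket N p) (traceForm Λ)))
      (M.map MvPolynomial.C) (genericMatrix N p)
    have hconst :
        entrywise (hamiltonian (glBracket N p) (traceForm Λ)) (M.map MvPolynomial.C) = 0 := by
      refine Matrix.ext fun A B => ?_
      exact MvPolynomial.derivation_C (hamiltonian (glBracket N p) (traceForm Λ)) (M A B)
    rw [hconst, zero_mul, zero_add] at hleibniz
    rw [← hleibniz]
    exact map_sum (hamiltonian (glBracket N p) (traceForm Λ)) _ _
  rw [← hamiltonian_glBracket, hM, entrywise_hamiltonian_traceForm, Ring.lie_def, mul_sub,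
    trace_sub, ← mul_assoc, ← mul_assoc, trace_mul_comm (_ * genericMatrix N p), ← mul_assoc,
    traceForm, traceForm, Matrix.map_mul, Matrix.map_mul]

theorem entrywise_hamiltonian_pow (n : ℕ) (A B : Fin N × Fin p) :
    entrywise (hamiltonian (glBracket N p) ((genericMatrix N p ^ n) A B)) (genericMatrix N p) =
      ⁅single B A (1 : Amb N p), genericMatrix N p ^ n⁆ := by
  refine Matrix.ext fun C D => ?_
  have h : glBracket N p (MvPolynomial.X (C, D)) ((genericMatrix N p ^ n) A B) =
      ⁅single D C (1 : Amb N p), genericMatrix N p ^ n⁆ A B := by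
    rw [← hamiltonian_glBracket, ← entrywise_apply, ← traceForm_single,
      entrywise_hamiltonian_traceForm_pow, map_single, map_one]
  rw [entrywise_apply, hamiltonian_glBracket, genericMatrix, of_apply, ← genericMatrix,
    glBracket_antisymm, h]
  simp only [Ring.lie_def, Matrix.sub_apply, single_one_mul_apply, mul_single_one_apply, neg_sub,
    eq_comm]

theorem glBracket_pow_pow (n m : ℕ) (A B C D : Fin N × Fin p) :
    glBracket N p ((genericMatrix N p ^ n) A B) ((genericMatrix N p ^ m) C D) =
      ∑ i ∈ Finset.range m,
        ((genericMatrix N p ^ i) C B * (genericMatrix N p ^ (n + (m - 1 - i))) A D -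
          (genericMatrix N p ^ (i + n)) C B * (genericMatrix N p ^ (m - 1 - i)) A D) := by
  have hsandwich (P Q : Matrix (Fin N × Fin p) (Fin N × Fin p) (Amb N p)) :
      (P * single B A (1 : Amb N p) * Q) C D = P C B * Q A D := by
    rw [mul_apply, Finset.sum_eq_single A (fun x _ hx => by
      rw [mul_single_one_apply, if_neg hx.symm, zero_mul]) (by simp), mul_single_one_apply,
      if_pos rfl]
  rw [← hamiltonian_glBracket, ← entrywise_apply, (isLeibniz_entrywise _).map_pow,
    Matrix.sum_apply]
  refine Finset.sum_congr rfl fun i _ => ?_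
  rw [entrywise_hamiltonian_pow, ← hsandwich, ← hsandwich, ← Matrix.sub_apply, Ring.lie_def]
  simp only [mul_sub, sub_mul, pow_add, mul_assoc]

theorem trace_dual_glBasis_mul_glBasis (x y : MultipletIndex p × Fin N × Fin N) :
    ((pairing p x.1.1 x.1.2)⁻¹ • glBasis N p x.1.1 (-x.1.2) x.2.2 x.2.1 *
      glBasis N p y.1.1 y.1.2 y.2.1 y.2.2).trace = if x = y then 1 else 0 := by
  obtain ⟨i, a, b⟩ := x
  obtain ⟨i', c, d⟩ := y
  rw [glBasis, glBasis, ← kronecker_smul, ← mul_kronecker_mul, trace_kronecker]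
  change _ * (dualMultiplet p i * _).trace = _
  rw [trace_dualMultiplet_mul_multiplet, trace_single_mul, single_apply]
  simp only [Prod.mk.injEq, smul_eq_mul, mul_ite, mul_one, mul_zero, ← ite_and]
  congr 1
  ext
  tauto

theorem genericMatrix_eq_sum_coord :
    genericMatrix N p = ∑ x : MultipletIndex p × Fin N × Fin N,
      coord N p x.1.1 x.1.2 x.2.1 x.2.2 •
        (glBasis N p x.1.1 x.1.2 x.2.1 x.2.2).map MvPolynomial.C := by
  have hcard : Fintype.card (MultipletIndex p × Fin N × Fin N) =
      Fintype.card (Fin N × Fin p) * Fintype.card (Fin N × Fin p) := by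
    simp only [Fintype.card_prod, card_multipletIndex, Fintype.card_fin]
    ring
  calc genericMatrix N p = ∑ x : MultipletIndex p × Fin N × Fin N,
        traceForm ((pairing p x.1.1 x.1.2)⁻¹ • glBasis N p x.1.1 (-x.1.2) x.2.2 x.2.1) •
          (glBasis N p x.1.1 x.1.2 x.2.1 x.2.2).map MvPolynomial.C := by
        refine eq_sum_trace_mul_smul hcard (fun x y => ?_) _
        rw [← Matrix.map_mul, ← AddMonoidHom.map_trace, trace_dual_glBasis_mul_glBasis]
        split_ifs <;> simp
    _ = _ := by simp only [traceForm_smul, coord_eq_smul_traceForm]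

end GlBracket

/-! ### Brackets on the gauge slice -/

section GaugeSlice

variable {N p : ℕ}

theorem gaugeFixed_apply (a b : Fin N) (k l : Fin p) :
    gaugeFixed N p (a, k) (b, l) = MvPolynomial.C (epsMinus N p (a, k) (b, l)) +
      if (k : ℕ) ≤ l then highest p (l - k) k l • W N p (l - k) a b else 0 := by
  have hentry (j : Fin p) : (∑ a', ∑ b', W N p j a' b' •
      (glBasis N p j (j : ℕ) a' b').map MvPolynomial.C) (a, k) (b, l) =
      highest p j k l • W N p j a b := by
    simp only [Matrix.sum_apply, Matrix.smul_apply, map_apply, glBasis, multiplet_self,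
      kroneckerMap_apply, single_apply, ite_and, ite_mul, one_mul, zero_mul, apply_ite, map_zero,
      smul_eq_mul, mul_zero]
    simp only [Finset.sum_ite_eq', Finset.sum_ite_irrel, Finset.sum_const_zero, Finset.mem_univ,
      if_true, MvPolynomial.smul_eq_C_mul, mul_comm]
  rw [gaugeFixed, Matrix.add_apply, Matrix.sum_apply, Finset.sum_congr rfl fun j _ => hentry j,
    map_apply]
  congr 1
  split_ifs with h
  · refine Finset.sum_eq_single (⟨l - k, by omega⟩ : Fin p) (fun j _ hj => ?_) (by simp)
    rw [highest_apply_of_ne fun hl => hj (Fin.ext (by simp only; omega)), zero_smul]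
  · exact Finset.sum_eq_zero fun j _ => by rw [highest_apply_of_ne (by omega), zero_smul]

/-- The degree on the rows and columns of `gl(Np)` with respect to which `E_{ab} ⊗ M_{j,m}` is
graded of degree `m`. -/
def level (A : Fin N × Fin p) : ℤ := (A.2 : ℕ)

theorem isGraded_kronecker (B : Matrix (Fin N) (Fin N) ℂ) {M : Matrix (Fin p) (Fin p) ℂ} {d : ℤ}
    (hM : IsGraded (fun k : Fin p => (k : ℤ)) d M) : IsGraded level d (B ⊗ₖ M) :=
  fun _ _ h => hM (right_ne_zero_of_mul h)

theorem isGraded_glBasis {j : ℕ} {m : ℤ} (hm : m ≤ j) (a b : Fin N) :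
    IsGraded level m (glBasis N p j m a b) :=
  isGraded_kronecker _ (isGraded_multiplet hm)

theorem lie_epsMinus_glBasis {j : ℕ} {m : ℤ} (hm : m ≤ j) (a b : Fin N) :
    ⁅epsMinus N p, glBasis N p j m a b⁆ = glBasis N p j (m - 1) a b := by
  rw [Ring.lie_def, epsMinus, glBasis, glBasis, ← mul_kronecker_mul, ← mul_kronecker_mul, one_mul,
    mul_one, ← adMinus_multiplet hm, adMinus_apply]
  ext
  simp only [Matrix.sub_apply, kroneckerMap_apply, mul_sub]

theorem trace_glBasis_mul_glBasis (j i : ℕ) (m n : ℤ) (a b c d : Fin N) :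
    (glBasis N p j m a b * glBasis N p i n c d).trace =
      if a = d ∧ b = c then (multiplet p j m * multiplet p i n).trace else 0 := by
  rw [glBasis, glBasis, ← mul_kronecker_mul, trace_kronecker, trace_single_mul, single_apply]
  simp only [smul_eq_mul, one_mul, ite_mul, zero_mul, eq_comm, and_comm]

theorem impose_genericMatrix (A B : Fin N × Fin p) :
    impose N p (genericMatrix N p A B) = gaugeFixed N p A B :=
  MvPolynomial.aeval_X _ _

theorem impose_genericMatrix_pow (n : ℕ) (A B : Fin N × Fin p) :
    impose N p ((genericMatrix N p ^ n) A B) = (gaugeFixed N p ^ n) A B := by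
  have h : (genericMatrix N p).map (impose N p) = gaugeFixed N p :=
    Matrix.ext impose_genericMatrix
  rw [← h, ← AlgHom.mapMatrix_apply, ← map_pow]
  rfl

theorem impose_traceForm {Λ : Matrix (Fin N × Fin p) (Fin N × Fin p) ℂ} {d : ℤ}
    (hΛ : IsGraded level d Λ) (hd : 1 ≤ d) :
    impose N p (traceForm Λ) = MvPolynomial.C (Λ * epsMinus N p).trace := by
  simp only [traceForm_eq_sum, map_sum, map_smul, Matrix.trace, diag_apply, mul_apply]
  refine Finset.sum_congr rfl fun A _ => Finset.sum_congr rfl fun B _ => ?_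
  by_cases hAB : Λ A B = 0
  · rw [hAB, zero_smul, zero_mul, map_zero]
  · have hlevel := hΛ hAB
    have hlt : ¬ (B.2 : ℕ) ≤ A.2 := by simp only [level] at hlevel; omega
    have hBA := impose_genericMatrix B A
    rw [gaugeFixed_apply, if_neg hlt, add_zero] at hBA
    rw [map_mul, ← MvPolynomial.smul_eq_C_mul, ← hBA]
    rfl

theorem impose_glBracket_traceForm {Λ M : Matrix (Fin N × Fin p) (Fin N × Fin p) ℂ} {d e : ℤ}
    (hΛ : IsGraded level d Λ) (hM : IsGraded level e M) (hde : 1 ≤ d + e) :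
    impose N p (glBracket N p (traceForm Λ) (traceForm M)) =
      MvPolynomial.C (-(M * ⁅epsMinus N p, Λ⁆).trace) := by
  rw [glBracket_traceForm_traceForm, map_sub, impose_traceForm (hM.mul hΛ) (by omega),
    impose_traceForm (hΛ.mul hM) hde, ← map_sub, Ring.lie_def, mul_sub, trace_sub, neg_sub,
    mul_assoc M, mul_assoc Λ, trace_mul_comm Λ, mul_assoc M]

theorem impose_glBracket_coord {j i : ℕ} {m n : ℤ} (hm : -m ≤ j) (hn : -n ≤ i) (h : n ≤ -1 - m)
    (a b c d : Fin N) :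
    impose N p (glBracket N p (coord N p j m a b) (coord N p i n c d)) =
      if d = a ∧ c = b then MvPolynomial.C (-((pairing p j m)⁻¹ * (pairing p i n)⁻¹ *
        (multiplet p i (-n) * multiplet p j (-m - 1)).trace)) else 0 := by
  rw [← hamiltonian_glBracket, coord_eq_smul_traceForm, coord_eq_smul_traceForm,
    Derivation.map_smul, hamiltonian_glBracket, glBracket_antisymm, ← hamiltonian_glBracket,
    Derivation.map_smul, hamiltonian_glBracket, glBracket_antisymm]
  simp only [smul_neg, neg_neg, map_smul]
  rw [impose_glBracket_traceForm (isGraded_glBasis hm b a) (isGraded_glBasis hn d c) (by omega),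
    lie_epsMinus_glBasis hm, trace_glBasis_mul_glBasis]
  split_ifs
  · simp only [MvPolynomial.smul_eq_C_mul, ← map_mul]
    ring_nf
  · simp only [neg_zero, map_zero, smul_zero]

end GaugeSlice

/-! ### The matrix of constraints -/

section DiracMatrix

variable {N p : ℕ}

theorem glBracket_constraint_right (f : Amb N p) (α : ConstraintIndex N p) :
    glBracket N p f (constraint N p α) =
      glBracket N p f (coord N p α.1.1 α.1.2 α.2.1 α.2.2) := by
  rw [← hamiltonian_glBracket, constraint, map_sub, MvPolynomial.derivation_C, sub_zero,
    hamiltonian_glBracket]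

theorem glBracket_constraint_left (α : ConstraintIndex N p) (g : Amb N p) :
    glBracket N p (constraint N p α) g =
      glBracket N p (coord N p α.1.1 α.1.2 α.2.1 α.2.2) g := by
  rw [glBracket_antisymm, glBracket_constraint_right, ← glBracket_antisymm]

/-- The involution `(j, m, a, b) ↦ (j, -1 - m, b, a)` of the labels of the constraints. Among
the constraints `(i, n, c, d)` with `n ≤ -1 - m`, the image of `(j, m, a, b)` is the only one whose
bracket with `(j, m, a, b)` does not vanish on the gauge slice. -/
def constraintSwap (N p : ℕ) : Equiv.Perm (ConstraintIndex N p) :=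
  Function.Involutive.toPerm
    (fun α => (⟨α.1.1, ⟨-1 - α.1.2, by
      have := Finset.mem_Ico.mp α.1.2.2
      exact Finset.mem_Ico.mpr ⟨by omega, by omega⟩⟩⟩, α.2.2, α.2.1))
    fun α => by simp only [sub_sub_cancel, Subtype.coe_eta, Sigma.eta, Prod.mk.eta]

theorem constraintSwap_constraintSwap (α : ConstraintIndex N p) :
    constraintSwap N p (constraintSwap N p α) = α :=
  (constraintSwap N p).left_inv α

/-- The order `-m` of a constraint `(j, m, a, b)`, for which `Δ` is block triangular up to
`constraintSwap`. -/
def constraintWeight (α : ConstraintIndex N p) : ℤ := -α.1.2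

theorem exists_diracMatrix_apply_constraintSwap (α : ConstraintIndex N p) :
    ∃ c : ℂ, c ≠ 0 ∧ ∀ β, constraintWeight β ≤ constraintWeight α →
      diracMatrix N p α (constraintSwap N p β) = if α = β then MvPolynomial.C c else 0 := by
  obtain ⟨⟨j, m, hm⟩, a, b⟩ := α
  have hmj := Finset.mem_Ico.mp hm
  refine ⟨-((pairing p j m)⁻¹ * (pairing p j (-1 - m))⁻¹ * pairing p j (1 + m)), ?_, ?_⟩
  · simp only [ne_eq, neg_eq_zero, mul_eq_zero, inv_eq_zero, not_or]
    exact ⟨⟨pairing_ne_zero j.2 (by omega) (by omega), pairing_ne_zero j.2 (by omega) (by omega)⟩,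
      pairing_ne_zero j.2 (by omega) (by omega)⟩
  · rintro ⟨⟨i, n, hn⟩, c, d⟩ hweight
    have hni := Finset.mem_Ico.mp hn
    simp only [constraintWeight] at hweight
    rw [diracMatrix, of_apply, glBracket_constraint_left, glBracket_constraint_right]
    change impose N p (glBracket N p (coord N p j m a b) (coord N p i (-1 - n) d c)) = _
    rw [impose_glBracket_coord (by omega) (by omega) (by omega)]
    split_ifs with hcd heq heq
    · cases heq
      rw [pairing, pairing, pairing]
      ring_nf
    · obtain ⟨rfl, rfl⟩ := hcd
      rw [trace_multiplet_mul_of_ne (by omega) (by omega), mul_zero, neg_zero, map_zero]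
      by_contra! h
      obtain ⟨hij, hmn⟩ := h
      obtain rfl := Fin.ext hij
      obtain rfl : m = n := by omega
      exact heq rfl
    · cases heq
      exact absurd ⟨rfl, rfl⟩ hcd
    · rfl

theorem blockTriangular_diracMatrix :
    BlockTriangular ((diracMatrix N p).submatrix id (constraintSwap N p)) constraintWeight := by
  intro α β hβα
  obtain ⟨c, -, hc⟩ := exists_diracMatrix_apply_constraintSwap α
  rw [submatrix_apply, id, hc β hβα.le, if_neg fun h => hβα.ne (by rw [h])]

theorem isUnit_det_diracMatrix : IsUnit (diracMatrix N p).det := by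
  choose c hc0 hc using exists_diracMatrix_apply_constraintSwap (N := N) (p := p)
  suffices h : IsUnit ((diracMatrix N p).submatrix id (constraintSwap N p)).det by
    rw [det_permute'] at h
    exact isUnit_of_mul_isUnit_right h
  rw [blockTriangular_diracMatrix.det]
  refine Finset.prod_induction _ IsUnit (fun _ _ => IsUnit.mul) isUnit_one fun w _ => ?_
  have hblock : ((diracMatrix N p).submatrix id (constraintSwap N p)).toSquareBlock
      constraintWeight w = diagonal fun α : { α // constraintWeight α = w } =>
        MvPolynomial.C (c α) := by
    refine Matrix.ext fun α β => ?_
    rw [toSquareBlock_def, of_apply, submatrix_apply, id, hc _ _ (β.2.trans α.2.symm).le,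
      diagonal_apply]
    simp only [Subtype.ext_iff]
  rw [hblock, det_diagonal]
  exact Finset.prod_induction _ IsUnit (fun _ _ => IsUnit.mul) isUnit_one
    fun α _ => (IsUnit.mk0 _ (hc0 α)).map _

theorem inv_diracMatrix_apply_eq_zero {α β : ConstraintIndex N p} (hα : 0 ≤ (α.1.2 : ℤ))
    (hβ : 0 ≤ (β.1.2 : ℤ)) : (diracMatrix N p)⁻¹ α β = 0 := by
  have hunit : IsUnit ((diracMatrix N p).submatrix id (constraintSwap N p)) :=
    (isUnit_submatrix_equiv (Equiv.refl _) (constraintSwap N p)).mpr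
      ((isUnit_iff_isUnit_det _).mpr isUnit_det_diracMatrix)
  let _ := hunit.invertible
  have hinv : ((diracMatrix N p).submatrix id (constraintSwap N p))⁻¹ =
      (diracMatrix N p)⁻¹.submatrix (constraintSwap N p) id :=
    inv_submatrix_equiv (diracMatrix N p) (Equiv.refl _) (constraintSwap N p)
  have htriangular :=
    blockTriangular_inv_of_blockTriangular (blockTriangular_diracMatrix (N := N) (p := p))
  rw [hinv] at htriangular
  have hweight : constraintWeight β < constraintWeight (constraintSwap N p α) := by
    change -(β.1.2 : ℤ) < -(-1 - (α.1.2 : ℤ))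
    omega
  have hzero := htriangular hweight
  rwa [submatrix_apply, id, constraintSwap_constraintSwap] at hzero

theorem diracMatrix_transpose : (diracMatrix N p)ᵀ = -diracMatrix N p :=
  Matrix.ext fun α β => by
    rw [transpose_apply, Matrix.neg_apply, diracMatrix, of_apply, of_apply, glBracket_antisymm,
      map_neg]

theorem inv_diracMatrix_transpose : ((diracMatrix N p)⁻¹)ᵀ = -(diracMatrix N p)⁻¹ := by
  rw [transpose_nonsing_inv, diracMatrix_transpose]
  exact inv_eq_left_inv (by rw [neg_mul_neg, nonsing_inv_mul _ isUnit_det_diracMatrix])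

end DiracMatrix

/-! ### The Dirac bracket and the corners of the gauge fixed matrix -/

section DiracBracket

variable {N p : ℕ}

theorem diracBracket_antisymm (f g : Amb N p) : diracBracket N p f g = -diracBracket N p g f := by
  have hinv (α β) : (diracMatrix N p)⁻¹ α β = -(diracMatrix N p)⁻¹ β α :=
    congrFun (congrFun inv_diracMatrix_transpose β) α
  rw [diracBracket, diracBracket, neg_sub, sub_eq_neg_add, sub_eq_add_neg _ (impose N p _),
    glBracket_antisymm f g, map_neg, add_left_inj, Finset.sum_comm, ← Finset.sum_neg_distrib]
  refine Finset.sum_congr rfl fun α _ => ?_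
  rw [← Finset.sum_neg_distrib]
  refine Finset.sum_congr rfl fun β _ => ?_
  rw [glBracket_antisymm f, glBracket_antisymm _ g, hinv, map_neg, map_neg]
  ring

theorem impose_glBracket_eq_sum (f g : Amb N p) : impose N p (glBracket N p f g) =
    ∑ x, impose N p (MvPolynomial.pderiv x g) *
      impose N p (glBracket N p f (MvPolynomial.X x)) := by
  rw [glBracket, biderivation_eq_sum_right, map_sum]
  simp only [map_mul]

theorem diracBracket_eq_sum (f g : Amb N p) : diracBracket N p f g =
    ∑ x, impose N p (MvPolynomial.pderiv x g) * diracBracket N p f (MvPolynomial.X x) := by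
  simp only [diracBracket, mul_sub, Finset.sum_sub_distrib]
  rw [impose_glBracket_eq_sum]
  congr 1
  simp only [impose_glBracket_eq_sum _ g, Finset.mul_sum]
  rw [Finset.sum_comm_cycle]
  refine Finset.sum_congr rfl fun x _ => Finset.sum_congr rfl fun α _ =>
    Finset.sum_congr rfl fun β _ => ?_
  ring

theorem diracBracket_constraint (f : Amb N p) (α : ConstraintIndex N p) :
    diracBracket N p f (constraint N p α) = 0 := by
  have hinv (β) : ∑ γ, (diracMatrix N p)⁻¹ β γ *
      impose N p (glBracket N p (constraint N p γ) (constraint N p α)) =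
        if β = α then 1 else 0 := by
    rw [← one_apply, ← nonsing_inv_mul _ isUnit_det_diracMatrix, mul_apply]
    rfl
  rw [diracBracket, sub_eq_zero]
  simp only [mul_assoc, ← Finset.mul_sum, hinv, mul_ite, mul_one, mul_zero, Finset.sum_ite_eq',
    Finset.mem_univ, if_true]

theorem diracBracket_coord (f : Amb N p) {j : Fin p} {m : ℤ} (hm : -j ≤ m) (hm' : m < j)
    (a b : Fin N) : diracBracket N p f (coord N p j m a b) = 0 := by
  have h := diracBracket_constraint f
    ((⟨j, m, Finset.mem_Ico.mpr ⟨hm, hm'⟩⟩, a, b) : ConstraintIndex N p)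
  rw [diracBracket_eq_sum] at h ⊢
  simpa only [constraint, map_sub, MvPolynomial.pderiv_C, sub_zero] using h

/-- The coordinate `J^{ab}_{jj}`, which the constraints leave free. -/
noncomputable def topCoord (i : Fin p × Fin N × Fin N) : Amb N p :=
  coord N p i.1 (i.1 : ℕ) i.2.1 i.2.2

theorem pderiv_gaugeFixed (i : Fin p × Fin N × Fin N) (A B : Fin N × Fin p) :
    MvPolynomial.pderiv i (gaugeFixed N p A B) =
      MvPolynomial.C (glBasis N p i.1 (i.1 : ℕ) i.2.1 i.2.2 A B) := by
  classical
  have h : gaugeFixed N p A B = MvPolynomial.C (epsMinus N p A B) +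
      ∑ k : Fin p × Fin N × Fin N,
        glBasis N p k.1 (k.1 : ℕ) k.2.1 k.2.2 A B • MvPolynomial.X k := by
    simp only [gaugeFixed, Matrix.add_apply, map_apply, Matrix.sum_apply, Matrix.smul_apply,
      Fintype.sum_prod_type, W, of_apply, Fin.is_lt, dif_pos, smul_eq_mul, mul_comm,
      MvPolynomial.smul_eq_C_mul]
  rw [h, map_add, MvPolynomial.pderiv_C, zero_add, map_sum, Finset.sum_eq_single i
    (fun k _ hk => by rw [Derivation.map_smul, MvPolynomial.pderiv_X_of_ne hk, smul_zero])
    (by simp), Derivation.map_smul, MvPolynomial.pderiv_X_self, MvPolynomial.smul_eq_C_mul,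
    mul_one]

theorem diracBracket_sum_mul {ι : Type*} (s : Finset ι) (c : ι → ℂ) (f : Amb N p)
    (g : ι → Amb N p) : diracBracket N p f (∑ i ∈ s, g i * MvPolynomial.C (c i)) =
      ∑ i ∈ s, MvPolynomial.C (c i) * diracBracket N p f (g i) := by
  rw [diracBracket_eq_sum]
  simp only [diracBracket_eq_sum f (g _), mul_comm (g _), ← MvPolynomial.smul_eq_C_mul, map_sum,
    map_smul, Derivation.map_smul, Finset.sum_mul, Finset.smul_sum, smul_mul_assoc]
  rw [Finset.sum_comm]

theorem diracBracket_X (f : Amb N p) (y : (Fin N × Fin p) × (Fin N × Fin p)) :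
    diracBracket N p f (MvPolynomial.X y) =
      ∑ i, MvPolynomial.pderiv i (gaugeFixed N p y.1 y.2) * diracBracket N p f (topCoord i) := by
  have hX : genericMatrix N p y.1 y.2 = ∑ x : MultipletIndex p × Fin N × Fin N,
      coord N p x.1.1 x.1.2 x.2.1 x.2.2 *
        MvPolynomial.C (glBasis N p x.1.1 x.1.2 x.2.1 x.2.2 y.1 y.2) := by
    have h := congrFun (congrFun (genericMatrix_eq_sum_coord (N := N) (p := p)) y.1) y.2
    simpa only [Matrix.sum_apply, Matrix.smul_apply, map_apply, smul_eq_mul] using h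
  change diracBracket N p f (genericMatrix N p y.1 y.2) = _
  rw [hX, diracBracket_sum_mul, Fintype.sum_prod_type, Fintype.sum_prod_type, Fintype.sum_sigma]
  refine Finset.sum_congr rfl fun j _ => ?_
  rw [Finset.sum_eq_single ⟨((j : ℕ) : ℤ), Finset.mem_Icc.mpr ⟨by omega, le_rfl⟩⟩ _ (by simp)]
  · simp only [pderiv_gaugeFixed]
    rfl
  · rintro ⟨m, hm⟩ - hne
    refine Finset.sum_eq_zero fun ab _ => ?_
    have hmj := Finset.mem_Icc.mp hm
    rw [diracBracket_coord f hmj.1 (lt_of_le_of_ne hmj.2 fun h => hne (Subtype.ext h)), mul_zero]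

theorem diracBracket_eq_sum_pderiv_impose (f g : Amb N p) : diracBracket N p f g =
    ∑ i, MvPolynomial.pderiv i (impose N p g) * diracBracket N p f (topCoord i) := by
  have hchain (i) : MvPolynomial.pderiv i (impose N p g) =
      ∑ x, impose N p (MvPolynomial.pderiv x g) *
        MvPolynomial.pderiv i (gaugeFixed N p x.1 x.2) := derivation_aeval _ _ g
  rw [diracBracket_eq_sum]
  simp only [hchain, diracBracket_X, Finset.mul_sum, Finset.sum_mul, mul_assoc]
  rw [Finset.sum_comm]

theorem wBracket_impose (f g : Amb N p) :
    wBracket N p (impose N p f) (impose N p g) = diracBracket N p f g := by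
  have hX (k) : wBracket N p (impose N p f) (MvPolynomial.X k) = diracBracket N p f (topCoord k) :=
    calc wBracket N p (impose N p f) (MvPolynomial.X k)
        = ∑ i, MvPolynomial.pderiv i (impose N p f) * diracBracket N p (topCoord i) (topCoord k) :=
          biderivation_X_right _ _ _
      _ = diracBracket N p f (topCoord k) := by
          rw [diracBracket_antisymm f, diracBracket_eq_sum_pderiv_impose, ← Finset.sum_neg_distrib]
          refine Finset.sum_congr rfl fun i _ => ?_
          rw [diracBracket_antisymm, mul_neg]
  calc wBracket N p (impose N p f) (impose N p g)
      = ∑ k, MvPolynomial.pderiv k (impose N p g) *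
          wBracket N p (impose N p f) (MvPolynomial.X k) := biderivation_eq_sum_right _ _ _
    _ = diracBracket N p f g := by simp only [hX, ← diracBracket_eq_sum_pderiv_impose]

theorem diracBracket_eq_impose_glBracket {f g : Amb N p}
    (hf : ∀ α : ConstraintIndex N p, (α.1.2 : ℤ) < 0 → glBracket N p f (constraint N p α) = 0)
    (hg : ∀ α : ConstraintIndex N p, (α.1.2 : ℤ) < 0 → glBracket N p (constraint N p α) g = 0) :
    diracBracket N p f g = impose N p (glBracket N p f g) := by
  rw [diracBracket, sub_eq_self]
  refine Finset.sum_eq_zero fun α _ => Finset.sum_eq_zero fun β _ => ?_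
  rcases lt_or_ge (α.1.2 : ℤ) 0 with hα | hα
  · rw [hf α hα, map_zero, zero_mul, zero_mul]
  · rcases lt_or_ge (β.1.2 : ℤ) 0 with hβ | hβ
    · rw [hg β hβ, map_zero, mul_zero]
    · rw [inv_diracMatrix_apply_eq_zero hα hβ, mul_zero, zero_mul]

variable {q : ℕ}

theorem glBracket_traceForm_pow_corner
    {Λ : Matrix (Fin N × Fin (q + 1)) (Fin N × Fin (q + 1)) ℂ} {d : ℤ} (hΛ : IsGraded level d Λ)
    (hd : 0 < d) (n : ℕ) (a b : Fin N) :
    glBracket N (q + 1) (traceForm Λ) ((genericMatrix N (q + 1) ^ n) (a, Fin.last q) (b, 0)) =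
      0 := by
  have hrow (B) : Λ (a, Fin.last q) B = 0 := by
    by_contra h
    have := hΛ h
    have := B.2.is_le
    simp only [level, Fin.val_last] at *
    omega
  have hcol (A) : Λ A (b, 0) = 0 := by
    by_contra h
    have := hΛ h
    simp only [level, Fin.val_zero] at *
    omega
  rw [← hamiltonian_glBracket, ← entrywise_apply, entrywise_hamiltonian_traceForm_pow, Ring.lie_def,
    Matrix.sub_apply, mul_apply, mul_apply]
  simp only [map_apply, hrow, hcol, map_zero, zero_mul, mul_zero, Finset.sum_const_zero, sub_zero]

theorem glBracket_constraint_pow_corner (α : ConstraintIndex N (q + 1)) (hα : (α.1.2 : ℤ) < 0)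
    (n : ℕ) (a b : Fin N) :
    glBracket N (q + 1) (constraint N (q + 1) α)
      ((genericMatrix N (q + 1) ^ n) (a, Fin.last q) (b, 0)) = 0 := by
  have hm := Finset.mem_Ico.mp α.1.2.2
  rw [glBracket_constraint_left, coord_eq_smul_traceForm, glBracket_antisymm,
    ← hamiltonian_glBracket, Derivation.map_smul, hamiltonian_glBracket, glBracket_antisymm,
    glBracket_traceForm_pow_corner (isGraded_glBasis (by omega) _ _) (by omega), neg_zero,
    smul_zero, neg_zero]

/-- The lower left `N × N` block of the `n`-th power of the gauge fixed matrix. -/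
noncomputable def corner (N q n : ℕ) : Matrix (Fin N) (Fin N) (WAlgebra N (q + 1)) :=
  of fun a b => (gaugeFixed N (q + 1) ^ n) (a, Fin.last q) (b, 0)

theorem wBracket_corner (n m : ℕ) (a b c d : Fin N) :
    wBracket N (q + 1) (corner N q n a b) (corner N q m c d) =
      ∑ i ∈ Finset.range m, (corner N q i c b * corner N q (n + (m - 1 - i)) a d -
        corner N q (i + n) c b * corner N q (m - 1 - i) a d) := by
  simp only [corner, of_apply]
  rw [← impose_genericMatrix_pow, ← impose_genericMatrix_pow, wBracket_impose,
    diracBracket_eq_impose_glBracket _ (glBracket_constraint_pow_corner · · m c d),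
    glBracket_pow_pow, map_sum]
  · simp only [map_sub, map_mul, impose_genericMatrix_pow]
  · intro α hα
    rw [glBracket_antisymm, glBracket_constraint_pow_corner α hα, neg_zero]

end DiracBracket

/-! ### Words in the matrices `W_s` -/

section Words

variable {N p : ℕ}

/-- The weight `∑ (sᵢ + 1)` of the word `W_{s₁} ⋯ W_{sₙ}`. -/
def wordWeight (s : List ℕ) : ℕ := s.sum + s.length

theorem wordWeight_append (s t : List ℕ) : wordWeight (s ++ t) = wordWeight s + wordWeight t := by
  simp only [wordWeight, List.sum_append, List.length_append]
  ring

theorem length_pos_of_wordWeight_pos {s : List ℕ} (h : 0 < wordWeight s) : 0 < s.length := by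
  rw [List.length_pos_iff]
  rintro rfl
  simp [wordWeight] at h

variable (N p)

/-- The product `W_{s₁} ⋯ W_{sₙ}`. -/
noncomputable def word (s : List ℕ) : Matrix (Fin N) (Fin N) (WAlgebra N p) :=
  (s.map (W N p)).prod

/-- The span of the words of weight `w`; there are none for `w < 0`. -/
noncomputable def homogeneous (w : ℤ) : Submodule ℂ (Matrix (Fin N) (Fin N) (WAlgebra N p)) :=
  Submodule.span ℂ {A | ∃ s, (wordWeight s : ℤ) = w ∧ word N p s = A}

/-- The span of the words of weight `w` with at least two letters. -/
noncomputable def decomposable (w : ℤ) : Submodule ℂ (Matrix (Fin N) (Fin N) (WAlgebra N p)) :=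
  Submodule.span ℂ {A | ∃ s, (wordWeight s : ℤ) = w ∧ 2 ≤ s.length ∧ word N p s = A}

variable {N p}

theorem word_append (s t : List ℕ) : word N p (s ++ t) = word N p s * word N p t := by
  simp only [word, List.map_append, List.prod_append]

theorem one_mem_homogeneous : (1 : Matrix (Fin N) (Fin N) (WAlgebra N p)) ∈ homogeneous N p 0 :=
  Submodule.subset_span ⟨[], by simp [wordWeight], by simp [word]⟩

theorem W_mem_homogeneous (j : ℕ) : W N p j ∈ homogeneous N p (j + 1) :=
  Submodule.subset_span ⟨[j], by simp [wordWeight], by simp [word]⟩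

theorem homogeneous_of_neg {w : ℤ} (hw : w < 0) : homogeneous N p w = ⊥ := by
  refine Submodule.span_eq_bot.mpr ?_
  rintro _ ⟨s, hs, -⟩
  omega

theorem mul_mem_homogeneous {u v : ℤ} {A B : Matrix (Fin N) (Fin N) (WAlgebra N p)}
    (hA : A ∈ homogeneous N p u) (hB : B ∈ homogeneous N p v) :
    A * B ∈ homogeneous N p (u + v) := by
  have h := Submodule.mul_mem_mul hA hB
  rw [homogeneous, homogeneous, Submodule.span_mul_span] at h
  refine Submodule.span_mono ?_ h
  rintro _ ⟨_, ⟨s, rfl, rfl⟩, _, ⟨t, rfl, rfl⟩, rfl⟩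
  exact ⟨s ++ t, by rw [wordWeight_append, Nat.cast_add], word_append s t⟩

theorem mul_mem_decomposable {u v : ℤ} (hu : 0 < u) (hv : 0 < v)
    {A B : Matrix (Fin N) (Fin N) (WAlgebra N p)}
    (hA : A ∈ homogeneous N p u) (hB : B ∈ homogeneous N p v) :
    A * B ∈ decomposable N p (u + v) := by
  have h := Submodule.mul_mem_mul hA hB
  rw [homogeneous, homogeneous, Submodule.span_mul_span] at h
  refine Submodule.span_mono ?_ h
  rintro _ ⟨_, ⟨s, rfl, rfl⟩, _, ⟨t, rfl, rfl⟩, rfl⟩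
  have hs := length_pos_of_wordWeight_pos (Int.natCast_pos.mp hu)
  have ht := length_pos_of_wordWeight_pos (Int.natCast_pos.mp hv)
  exact ⟨s ++ t, by rw [wordWeight_append, Nat.cast_add], by rw [List.length_append]; omega,
    word_append s t⟩

theorem exists_sub_smul_W_mem_decomposable {j : ℕ} {A : Matrix (Fin N) (Fin N) (WAlgebra N p)}
    (hA : A ∈ homogeneous N p (j + 1)) : ∃ c : ℂ, A - c • W N p j ∈ decomposable N p (j + 1) := by
  have hle : homogeneous N p (j + 1) ≤ Submodule.span ℂ {W N p j} ⊔ decomposable N p (j + 1) := by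
    refine Submodule.span_le.mpr ?_
    rintro _ ⟨s, hs, rfl⟩
    match s with
    | [] => simp only [wordWeight, List.sum_nil, List.length_nil] at hs; omega
    | [i] =>
      obtain rfl : i = j := by
        simp only [wordWeight, List.sum_singleton, List.length_singleton] at hs
        omega
      have hword : word N p [i] = W N p i := List.prod_singleton
      rw [hword]
      exact Submodule.mem_sup_left (Submodule.mem_span_singleton_self _)
    | i :: k :: t =>
      exact Submodule.mem_sup_right (Submodule.subset_span ⟨_, hs, by simp, rfl⟩)
  obtain ⟨B, hB, D, hD, rfl⟩ := Submodule.mem_sup.mp (hle hA)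
  obtain ⟨c, rfl⟩ := Submodule.mem_span_singleton.mp hB
  exact ⟨c, by rwa [add_sub_cancel_left]⟩

theorem W_apply_of_lt {j : ℕ} (hj : j < p) (a b : Fin N) :
    W N p j a b = MvPolynomial.X (⟨j, hj⟩, a, b) := by
  rw [W, of_apply, dif_pos hj]

theorem constantCoeff_W (j : ℕ) (a b : Fin N) :
    MvPolynomial.constantCoeff (W N p j a b) = 0 := by
  rw [W, of_apply]
  split_ifs <;> simp

theorem constantCoeff_pderiv_of_mem_decomposable {w : ℤ}
    {A : Matrix (Fin N) (Fin N) (WAlgebra N p)} (hA : A ∈ decomposable N p w)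
    (i : Fin p × Fin N × Fin N) (a b : Fin N) :
    MvPolynomial.constantCoeff (MvPolynomial.pderiv i (A a b)) = 0 := by
  have hconst (j : ℕ) (s : List ℕ) (a b : Fin N) :
      MvPolynomial.constantCoeff (word N p (j :: s) a b) = 0 := by
    rw [word, List.map_cons, List.prod_cons, mul_apply, map_sum]
    exact Finset.sum_eq_zero fun c _ => by rw [map_mul, constantCoeff_W, zero_mul]
  induction hA using Submodule.span_induction with
  | mem A hA =>
    obtain ⟨s, -, hs, rfl⟩ := hA
    match s with
    | j :: k :: t =>
      have hcons : word N p (j :: k :: t) = W N p j * word N p (k :: t) := List.prod_cons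
      rw [hcons, mul_apply, map_sum, map_sum]
      refine Finset.sum_eq_zero fun c _ => ?_
      rw [Derivation.leibniz, map_add, smul_eq_mul, smul_eq_mul, map_mul, map_mul, constantCoeff_W,
        hconst, zero_mul, zero_mul, add_zero]
  | zero => simp
  | add A B _ _ hA hB => rw [Matrix.add_apply, map_add, map_add, hA, hB, add_zero]
  | smul c A _ hA =>
    rw [Matrix.smul_apply, Derivation.map_smul, MvPolynomial.smul_eq_C_mul, map_mul, hA, mul_zero]

end Words

/-! ### Corners of the powers of the gauge fixed matrix -/

section Corner

variable {N p q : ℕ}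

variable (N p) in
/-- The `(k, l)` block, of size `N × N`, of the `n`-th power of the gauge fixed matrix. -/
noncomputable def block (n : ℕ) (k l : Fin p) : Matrix (Fin N) (Fin N) (WAlgebra N p) :=
  of fun a b => (gaugeFixed N p ^ n) (a, k) (b, l)

theorem block_zero (k l : Fin p) : block N p 0 k l = if k = l then 1 else 0 := by
  ext1 a b
  by_cases h : k = l <;> simp [block, one_apply, h]

theorem block_one (k l : Fin p) : block N p 1 k l = eMinus p k l • 1 +
    if (k : ℕ) ≤ l then highest p (l - k) k l • W N p (l - k) else 0 := by
  ext1 a b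
  rw [block, of_apply, pow_one, gaugeFixed_apply, Matrix.add_apply]
  congr 1
  · by_cases h : a = b
    · simp [h, epsMinus, MvPolynomial.smul_eq_C_mul]
    · simp [h, epsMinus]
  · split_ifs <;> rfl

theorem block_succ (n : ℕ) (k l : Fin p) :
    block N p (n + 1) k l = ∑ m, block N p n k m * block N p 1 m l := by
  ext1 a b
  simp only [block, of_apply, pow_succ _ n, mul_apply, Fintype.sum_prod_type, pow_one,
    Matrix.sum_apply]
  rw [Finset.sum_comm]

theorem block_one_mem_homogeneous (k l : Fin p) :
    block N p 1 k l ∈ homogeneous N p (1 + l - k) := by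
  rw [block_one]
  refine add_mem ?_ ?_
  · rw [eMinus_apply]
    split_ifs with h
    · have hweight : (1 + l - k : ℤ) = 0 := by omega
      rw [one_smul, hweight]
      exact one_mem_homogeneous
    · rw [zero_smul]
      exact zero_mem _
  · split_ifs with h
    · have hweight : (1 + l - k : ℤ) = (l - k : ℕ) + 1 := by omega
      rw [hweight]
      exact Submodule.smul_mem _ _ (W_mem_homogeneous _)
    · exact zero_mem _

theorem block_mem_homogeneous (n : ℕ) (k l : Fin p) :
    block N p n k l ∈ homogeneous N p (n + l - k) := by
  induction n generalizing l with
  | zero =>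
    rw [block_zero]
    split_ifs with h
    · simpa [h] using one_mem_homogeneous
    · exact zero_mem _
  | succ n ih =>
    rw [block_succ]
    refine Submodule.sum_mem _ fun m _ => ?_
    have hweight : ((n + 1 : ℕ) + l - k : ℤ) = (n + m - k) + (1 + l - m) := by push_cast; ring
    rw [hweight]
    exact mul_mem_homogeneous (ih m) (block_one_mem_homogeneous m l)

theorem corner_mem_homogeneous (n : ℕ) : corner N q n ∈ homogeneous N (q + 1) (n - q) := by
  have h := block_mem_homogeneous (N := N) n (Fin.last q) 0
  rwa [Fin.val_zero, Fin.val_last, Nat.cast_zero, add_zero] at h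

theorem corner_eq_zero {n : ℕ} (h : n < q) : corner N q n = 0 := by
  have hmem := corner_mem_homogeneous (N := N) (q := q) n
  rwa [homogeneous_of_neg (by omega), Submodule.mem_bot] at hmem

theorem kronecker_pow {R m n : Type*} [CommSemiring R] [Fintype m] [DecidableEq m] [Fintype n]
    [DecidableEq n] (A : Matrix m m R) (B : Matrix n n R) (k : ℕ) :
    (A ⊗ₖ B) ^ k = (A ^ k) ⊗ₖ (B ^ k) := by
  induction k with
  | zero => simp
  | succ k ih => rw [pow_succ, ih, ← mul_kronecker_mul, ← pow_succ, ← pow_succ]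

theorem map_constantCoeff_gaugeFixed_pow (n : ℕ) :
    (MvPolynomial.constantCoeff.mapMatrix (gaugeFixed N p ^ n) : Matrix _ _ ℂ) =
      1 ⊗ₖ (eMinus p ^ n) := by
  have h : (MvPolynomial.constantCoeff.mapMatrix (gaugeFixed N p) : Matrix _ _ ℂ) =
      1 ⊗ₖ eMinus p := by
    ext ⟨a, k⟩ ⟨b, l⟩
    rw [RingHom.mapMatrix_apply, map_apply, gaugeFixed_apply, map_add, MvPolynomial.constantCoeff_C,
      apply_ite MvPolynomial.constantCoeff, MvPolynomial.smul_eq_C_mul, map_mul, constantCoeff_W,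
      mul_zero, map_zero, ite_self, add_zero, epsMinus]
  rw [map_pow, h, kronecker_pow, one_pow]

theorem corner_self : corner N q q = 1 := by
  rcases isEmpty_or_nonempty (Fin N) with _ | ⟨⟨a⟩⟩
  · exact Subsingleton.elim _ _
  have hle : homogeneous N (q + 1) 0 ≤ Submodule.span ℂ {1} := by
    refine Submodule.span_le.mpr ?_
    rintro _ ⟨s, hs, rfl⟩
    obtain rfl : s = [] := by
      rw [← List.length_eq_zero_iff]
      simp only [wordWeight] at hs
      omega
    exact Submodule.mem_span_singleton_self _
  have hmem := corner_mem_homogeneous (N := N) (q := q) q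
  rw [sub_self] at hmem
  obtain ⟨c, hc⟩ := Submodule.mem_span_singleton.mp (hle hmem)
  have hconst : MvPolynomial.constantCoeff (corner N q q a a) = 1 := by
    have h := congrFun (congrFun (map_constantCoeff_gaugeFixed_pow (N := N) (p := q + 1) q)
      (a, Fin.last q)) (a, 0)
    rw [kroneckerMap_apply, one_apply_eq, eMinus_pow_apply, if_pos (by simp), one_mul] at h
    exact h
  rw [← hc, Matrix.smul_apply, one_apply_eq, MvPolynomial.smul_eq_C_mul, mul_one,
    MvPolynomial.constantCoeff_C] at hconst
  rw [← hc, hconst, one_smul]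

/-- The coefficient of `W_j` in the corner of weight `j + 1`: the sum of the entries of
`M_{j,j}`. -/
noncomputable def cornerCoeff (q j : ℕ) : ℂ :=
  ∑ x : Fin (q + 1), ∑ y : Fin (q + 1), highest (q + 1) j x y

theorem sum_eMinus_pow_mul_highest_mul_eMinus_pow (q j : ℕ) :
    ∑ i ∈ Finset.range (q + (j + 1)), (eMinus (q + 1) ^ i * highest (q + 1) j *
      eMinus (q + 1) ^ (q + (j + 1) - 1 - i)) (Fin.last q) 0 = cornerCoeff q j := by
  simp only [mul_apply, Finset.sum_mul]
  refine (Finset.sum_comm.trans (Finset.sum_congr rfl fun y _ => ?_)).trans Finset.sum_comm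
  rw [Finset.sum_comm]
  refine Finset.sum_congr rfl fun x _ => ?_
  by_cases hxy : (y : ℕ) = x + j
  · rw [Finset.sum_eq_single (q - x) (fun i _ hi => ?_) (fun h => ?_)]
    · rw [eMinus_pow_apply, eMinus_pow_apply, if_pos (by rw [Fin.val_last]; omega),
        if_pos (by rw [Fin.val_zero]; omega), one_mul, mul_one]
    · rw [eMinus_pow_apply, if_neg (by rw [Fin.val_last]; omega), zero_mul, zero_mul]
    · exact absurd (Finset.mem_range.mpr (by omega)) h
  · simp only [highest_apply_of_ne hxy, mul_zero, zero_mul, Finset.sum_const_zero]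

theorem constantCoeff_pderiv_corner (n : ℕ) (j : Fin (q + 1)) (a : Fin N) :
    MvPolynomial.constantCoeff (MvPolynomial.pderiv (j, a, a) (corner N q n a a)) =
      ∑ i ∈ Finset.range n, (eMinus (q + 1) ^ i * highest (q + 1) j *
        eMinus (q + 1) ^ (n - 1 - i)) (Fin.last q) 0 := by
  have hG : (MvPolynomial.constantCoeff.mapMatrix
      (entrywise (MvPolynomial.pderiv (j, a, a)) (gaugeFixed N (q + 1))) : Matrix _ _ ℂ) =
      single a a 1 ⊗ₖ highest (q + 1) j := by
    ext A B
    rw [RingHom.mapMatrix_apply, map_apply, entrywise_apply, pderiv_gaugeFixed,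
      MvPolynomial.constantCoeff_C, glBasis, multiplet_self]
  have hpow := congrArg MvPolynomial.constantCoeff.mapMatrix
    ((isLeibniz_entrywise (MvPolynomial.pderiv (j, a, a))).map_pow (gaugeFixed N (q + 1)) n)
  simp only [map_sum, map_mul, hG, map_constantCoeff_gaugeFixed_pow, ← mul_kronecker_mul, one_mul,
    mul_one] at hpow
  have h := congrFun (congrFun hpow (a, Fin.last q)) (a, 0)
  simp only [Matrix.sum_apply, kroneckerMap_apply, single_apply_same, one_mul] at h
  exact h

theorem cornerCoeff_zero (q : ℕ) : cornerCoeff q 0 = (q + 1 : ℕ) := by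
  simp [cornerCoeff, highest_zero, one_apply]

theorem cornerCoeff_one (q : ℕ) :
    cornerCoeff q 1 = ((q + 1 : ℕ) : ℂ) * (((q + 1 : ℕ) : ℂ) ^ 2 - 1) / 6 := by
  have hrow (x : Fin (q + 1)) :
      ∑ y : Fin (q + 1), highest (q + 1) 1 x y = ((x : ℕ) + 1) * ((q : ℂ) - (x : ℕ)) := by
    rcases lt_or_eq_of_le x.is_le with hx | hx
    · rw [Finset.sum_eq_single (⟨x + 1, by omega⟩ : Fin (q + 1))
        (fun y _ hy => highest_apply_of_ne fun h => hy (Fin.ext h)) (by simp),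
        highest_one_apply rfl]
      push_cast
      ring
    · rw [hx, sub_self, mul_zero]
      exact Finset.sum_eq_zero fun y _ => highest_apply_of_ne (by omega)
  have hsum (n : ℕ) (c : ℂ) : ∑ k ∈ Finset.range n, ((k : ℂ) + 1) * (c - k) =
      c * (n * (n + 1) / 2) - (n - 1) * n * (n + 1) / 3 := by
    induction n with
    | zero => simp
    | succ n ih =>
      rw [Finset.sum_range_succ, ih]
      push_cast
      ring
  rw [cornerCoeff, Finset.sum_congr rfl fun x _ => hrow x,
    Fin.sum_univ_eq_sum_range (fun k => ((k : ℂ) + 1) * ((q : ℂ) - k)), hsum]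
  push_cast
  ring

open scoped ComplexOrder in
theorem cornerCoeff_ne_zero {j : ℕ} (hj : j < q + 1) : cornerCoeff q j ≠ 0 := by
  refine ne_of_gt (Finset.sum_pos' (fun x _ => Finset.sum_nonneg fun y _ => highest_nonneg ..)
    ⟨0, Finset.mem_univ _, Finset.sum_pos' (fun y _ => highest_nonneg ..)
      ⟨⟨j, hj⟩, Finset.mem_univ _, highest_pos (by simp)⟩⟩)

theorem corner_sub_mem_decomposable (j : ℕ) :
    corner N q (q + (j + 1)) - cornerCoeff q j • W N (q + 1) j ∈
      decomposable N (q + 1) (j + 1) := by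
  rcases isEmpty_or_nonempty (Fin N) with _ | ⟨⟨a⟩⟩
  · rw [Subsingleton.elim (corner N q (q + (j + 1)) - _) 0]
    exact zero_mem _
  have hmem := corner_mem_homogeneous (N := N) (q := q) (q + (j + 1))
  have hweight : ((q + (j + 1) : ℕ) - q : ℤ) = j + 1 := by push_cast; ring
  rw [hweight] at hmem
  obtain ⟨c, hc⟩ := exists_sub_smul_W_mem_decomposable hmem
  rcases lt_or_ge j (q + 1) with hj | hj
  · have h := constantCoeff_pderiv_of_mem_decomposable hc (⟨j, hj⟩, a, a) a a
    rw [Matrix.sub_apply, map_sub, map_sub, constantCoeff_pderiv_corner,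
      sum_eMinus_pow_mul_highest_mul_eMinus_pow, Matrix.smul_apply, Derivation.map_smul,
      W_apply_of_lt hj, MvPolynomial.pderiv_X_self, MvPolynomial.smul_eq_C_mul, mul_one,
      MvPolynomial.constantCoeff_C, sub_eq_zero] at h
    rwa [h]
  · have hW : W N (q + 1) j = 0 := by
      ext1
      rw [W, of_apply, dif_neg (by omega), Matrix.zero_apply]
    rwa [hW, smul_zero] at hc ⊢

end Corner

/-! ### Specialisation at `W_0` with equal entries -/

section Specialize

open Polynomial

variable {N p q : ℕ}

variable (N p) in
/-- The specialisation `W_0^{ab} ↦ X`, `W_s^{ab} ↦ 0` for `s > 0`, used to bound degrees from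
below. -/
noncomputable def specialize : WAlgebra N p →ₐ[ℂ] ℂ[X] :=
  MvPolynomial.aeval fun i => if (i.1 : ℕ) = 0 then X else 0

variable (N) in
/-- The matrix all of whose entries are `X`. -/
noncomputable def constMatrix : Matrix (Fin N) (Fin N) ℂ[X] := of fun _ _ => X

theorem natDegree_specialize_le (f : WAlgebra N p) :
    (specialize N p f).natDegree ≤ f.totalDegree := by
  refine (MvPolynomial.aeval_natDegree_le f le_rfl _ (n := 1) fun i => ?_).trans (by simp)
  split_ifs <;> simp

theorem constMatrix_pow_apply (n : ℕ) (a b : Fin N) :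
    (constMatrix N ^ (n + 1)) a b = C ((N : ℂ) ^ n) * X ^ (n + 1) := by
  induction n generalizing b with
  | zero => simp [constMatrix]
  | succ n ih =>
    rw [pow_succ, mul_apply, Finset.sum_congr rfl fun c _ => by rw [ih, constMatrix, of_apply],
      Finset.sum_const, Finset.card_univ, Fintype.card_fin, nsmul_eq_mul, pow_succ (N : ℂ), C_mul,
      C_eq_natCast]
    ring

theorem specialize_W_apply (s : ℕ) (a b : Fin N) :
    specialize N (q + 1) (W N (q + 1) s a b) = if s = 0 then X else 0 := by
  rw [W, of_apply]
  split_ifs with h h0 h0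
  · simp [specialize, h0]
  · simp [specialize, h0]
  · omega
  · rw [map_zero]

theorem specialize_W_zero : (specialize N (q + 1)).mapMatrix (W N (q + 1) 0) = constMatrix N := by
  ext1 a b
  rw [AlgHom.mapMatrix_apply, map_apply, specialize_W_apply, if_pos rfl, constMatrix, of_apply]

theorem specialize_W_succ (s : ℕ) :
    (specialize N (q + 1)).mapMatrix (W N (q + 1) (s + 1)) = 0 := by
  ext1 a b
  rw [AlgHom.mapMatrix_apply, map_apply, specialize_W_apply, if_neg s.succ_ne_zero,
    Matrix.zero_apply]

theorem specialize_gaugeFixed : (specialize N (q + 1)).mapMatrix (gaugeFixed N (q + 1)) =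
    constMatrix N ⊗ₖ 1 + 1 ⊗ₖ (eMinus (q + 1)).map C := by
  ext1 ⟨a, k⟩ ⟨b, l⟩
  rw [AlgHom.mapMatrix_apply, map_apply, gaugeFixed_apply, map_add, Matrix.add_apply, add_comm]
  congr 1
  · simp only [kroneckerMap_apply, constMatrix, of_apply]
    split_ifs with hle
    · rw [map_smul, specialize_W_apply]
      by_cases hkl : k = l
      · rw [hkl, Nat.sub_self, if_pos rfl, highest_zero, one_apply_eq, one_apply_eq, one_smul,
          mul_one]
      · rw [if_neg (fun h => hkl (Fin.ext (by omega))), one_apply_ne hkl, smul_zero, mul_zero]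
    · rw [one_apply_ne (fun hkl => hle (congrArg Fin.val hkl).le), map_zero, mul_zero]
  · simp only [specialize, epsMinus, kroneckerMap_apply, map_apply, MvPolynomial.aeval_C,
      algebraMap_eq, one_apply, ite_mul, one_mul, zero_mul, apply_ite C, map_zero]

theorem specialize_gaugeFixed_pow (n : ℕ) :
    (specialize N (q + 1)).mapMatrix (gaugeFixed N (q + 1) ^ n) = ∑ m ∈ Finset.range (n + 1),
      n.choose m • (constMatrix N ^ m) ⊗ₖ ((eMinus (q + 1) ^ (n - m)).map C) := by
  have hcomm : Commute (constMatrix N ⊗ₖ (1 : Matrix (Fin (q + 1)) (Fin (q + 1)) ℂ[X]))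
      (1 ⊗ₖ (eMinus (q + 1)).map C) := by
    rw [Commute, SemiconjBy, ← mul_kronecker_mul, ← mul_kronecker_mul, one_mul, mul_one, one_mul,
      mul_one]
  have hpow (m : ℕ) : ((eMinus (q + 1)).map C) ^ m = ((eMinus (q + 1)) ^ m).map (C : ℂ →+* ℂ[X]) :=
    (map_pow C.mapMatrix _ _).symm
  rw [map_pow, specialize_gaugeFixed, hcomm.add_pow]
  refine Finset.sum_congr rfl fun m _ => ?_
  rw [kronecker_pow, kronecker_pow, hpow, ← mul_kronecker_mul, one_pow, one_pow, one_mul, mul_one,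
    nsmul_eq_mul, Nat.cast_comm]

theorem specialize_corner (n : ℕ) : (specialize N (q + 1)).mapMatrix (corner N q (q + n)) =
    (q + n).choose n • constMatrix N ^ n := by
  ext1 a b
  have h := congrFun (congrFun (specialize_gaugeFixed_pow (N := N) (q := q) (q + n))
    (a, Fin.last q)) (b, 0)
  have hentry {m : ℕ} (hm : m ≤ q + n) :
      (eMinus (q + 1) ^ (q + n - m)) (Fin.last q) 0 = if m = n then 1 else 0 := by
    rw [eMinus_pow_apply, Fin.val_last, Fin.val_zero]
    exact if_congr (by omega) rfl rfl
  rw [Matrix.sum_apply, Finset.sum_eq_single n] at h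
  · rw [Matrix.smul_apply, kroneckerMap_apply, map_apply, hentry (by omega), if_pos rfl, map_one,
      mul_one] at h
    exact h
  · intro m hmem hm
    rw [Matrix.smul_apply, kroneckerMap_apply, map_apply,
      hentry (by have := Finset.mem_range.mp hmem; omega), if_neg hm, map_zero, mul_zero, smul_zero]
  · intro hn
    exact absurd (Finset.mem_range.mpr (by omega)) hn

theorem totalDegree_eq_of_specialize {j : ℕ} {A : Matrix (Fin N) (Fin N) (WAlgebra N p)}
    {c : ℕ} (hc : c ≠ 0) (h : (specialize N p).mapMatrix A = c • constMatrix N ^ (j + 1))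
    {a b : Fin N} (hA : (A a b).totalDegree ≤ j + 1) : (A a b).totalDegree = j + 1 := by
  refine hA.antisymm ?_
  have hab : specialize N p (A a b) = C ((c : ℂ) * (N : ℂ) ^ j) * X ^ (j + 1) := by
    have h' := congrFun (congrFun h a) b
    rw [Matrix.smul_apply, constMatrix_pow_apply, nsmul_eq_mul, ← mul_assoc, ← C_eq_natCast,
      ← C_mul] at h'
    exact h'
  have hN : (N : ℂ) ≠ 0 := Nat.cast_ne_zero.mpr a.pos.ne'
  calc j + 1 = (specialize N p (A a b)).natDegree := by
        rw [hab, natDegree_C_mul_X_pow _ _ (mul_ne_zero (Nat.cast_ne_zero.mpr hc)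
          (pow_ne_zero _ hN))]
    _ ≤ (A a b).totalDegree := natDegree_specialize_le _

theorem corner_add_one : corner N q (q + 1) = ((q + 1 : ℕ) : ℂ) • W N (q + 1) 0 := by
  have hbot : decomposable N (q + 1) ((0 : ℕ) + 1) = ⊥ := by
    refine Submodule.span_eq_bot.mpr ?_
    rintro _ ⟨s, hs, hlen, -⟩
    simp only [wordWeight] at hs
    omega
  have h := corner_sub_mem_decomposable (N := N) (q := q) 0
  rwa [hbot, Submodule.mem_bot, sub_eq_zero, cornerCoeff_zero] at h

theorem corner_add_two : corner N q (q + 2) = cornerCoeff q 1 • W N (q + 1) 1 +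
    ((q + 2).choose 2 : ℂ) • (W N (q + 1) 0 * W N (q + 1) 0) := by
  rcases isEmpty_or_nonempty (Fin N) with _ | ⟨⟨a⟩⟩
  · exact Subsingleton.elim _ _
  have hle : decomposable N (q + 1) ((1 : ℕ) + 1) ≤
      Submodule.span ℂ {W N (q + 1) 0 * W N (q + 1) 0} := by
    refine Submodule.span_le.mpr ?_
    rintro _ ⟨s, hs, hlen, rfl⟩
    simp only [wordWeight] at hs
    match s with
    | [i, k] =>
      simp only [List.sum_cons, List.sum_nil, List.length_cons, List.length_nil] at hs
      obtain ⟨rfl, rfl⟩ : i = 0 ∧ k = 0 := by omega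
      rw [word, List.map_cons, List.map_singleton, List.prod_pair]
      exact Submodule.mem_span_singleton_self _
    | i :: k :: l :: t => simp only [List.length_cons] at hs; omega
  obtain ⟨c, hc⟩ := Submodule.mem_span_singleton.mp
    (hle (corner_sub_mem_decomposable (N := N) (q := q) 1))
  have h := congrFun (congrFun (congrArg (specialize N (q + 1)).mapMatrix hc) a) a
  rw [map_sub, map_smul, map_smul, map_mul, specialize_corner, specialize_W_zero, specialize_W_succ,
    smul_zero, sub_zero, ← sq, Matrix.smul_apply, Matrix.smul_apply, constMatrix_pow_apply,
    smul_eq_C_mul, nsmul_eq_mul, ← C_eq_natCast] at h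
  have hN : (N : ℂ) ^ 1 ≠ 0 := pow_ne_zero _ (Nat.cast_ne_zero.mpr a.pos.ne')
  have hne : C ((N : ℂ) ^ 1) * X ^ (1 + 1) ≠ 0 :=
    mul_ne_zero (C_ne_zero.mpr hN) (pow_ne_zero _ X_ne_zero)
  rw [← C_injective (mul_right_cancel₀ hne h), hc, add_sub_cancel]

end Specialize

/-! ### Generators triangular in the `W_s` -/

section Triangular

variable {N p : ℕ}

theorem exists_eq_sum_words {j : ℕ} {A : Matrix (Fin N) (Fin N) (WAlgebra N p)}
    (hA : A ∈ homogeneous N p (j + 1)) : ∃ α : (n : ℕ) → (Fin n → ℕ) → ℂ, A =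
      ∑ n ∈ Finset.Icc 1 (j + 1), ∑ s ∈ Finset.Nat.antidiagonalTuple n (j + 1 - n),
        α n s • (List.ofFn fun i => W N p (s i)).prod := by
  set words : Finset (Σ n, Fin n → ℕ) :=
    (Finset.Icc 1 (j + 1)).sigma fun n => Finset.Nat.antidiagonalTuple n (j + 1 - n)
  have hspan : A ∈ Submodule.span ℂ
      ((fun x : Σ n, Fin n → ℕ => word N p (List.ofFn x.2)) '' words) := by
    refine Submodule.span_mono ?_ hA
    rintro _ ⟨s, hs, rfl⟩
    have hlen := length_pos_of_wordWeight_pos (s := s) (by omega)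
    have hsum : ∑ i, s.get i = s.sum := by rw [← List.sum_ofFn, List.ofFn_get]
    simp only [wordWeight] at hs
    refine ⟨⟨s.length, s.get⟩, ?_, by simp only [List.ofFn_get]⟩
    rw [Finset.mem_coe, Finset.mem_sigma, Finset.mem_Icc, Finset.Nat.mem_antidiagonalTuple]
    simp only [hsum]
    omega
  obtain ⟨α, rfl⟩ := (Submodule.mem_span_image_finset_iff_exists_fun' ℂ).mp hspan
  refine ⟨fun n s => α ⟨n, s⟩, (Finset.sum_sigma _ _ _).trans ?_⟩
  simp only [word, List.map_ofFn, Function.comp_def]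

theorem exists_forall_eq_sum_words {V : ℕ → Matrix (Fin N) (Fin N) (WAlgebra N p)}
    (hV : ∀ j : ℕ, V j ∈ homogeneous N p (j + 1)) :
    ∃ α : (n : ℕ) → (Fin n → ℕ) → ℂ, ∀ j, V j =
      ∑ n ∈ Finset.Icc 1 (j + 1), ∑ s ∈ Finset.Nat.antidiagonalTuple n (j + 1 - n),
        α n s • (List.ofFn fun i => W N p (s i)).prod := by
  choose α hα using fun j => exists_eq_sum_words (hV j)
  refine ⟨fun n s => α (n + ∑ i, s i - 1) n s, fun j => (hα j).trans ?_⟩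
  refine Finset.sum_congr rfl fun n hn => Finset.sum_congr rfl fun s hs => ?_
  rw [Finset.mem_Icc] at hn
  beta_reduce
  rw [Finset.Nat.mem_antidiagonalTuple.mp hs, Nat.add_sub_cancel' hn.2, Nat.add_sub_cancel]

theorem totalDegree_word_le (s : List ℕ) (a b : Fin N) :
    (word N p s a b).totalDegree ≤ s.length := by
  have hW (j : ℕ) (a b : Fin N) : (W N p j a b).totalDegree ≤ 1 := by
    rw [W, of_apply]
    split_ifs <;> simp
  induction s generalizing a with
  | nil => by_cases h : a = b <;> simp [word, h]
  | cons j s ih =>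
    have hcons : word N p (j :: s) = W N p j * word N p s := List.prod_cons
    rw [hcons, mul_apply, List.length_cons, add_comm]
    refine MvPolynomial.totalDegree_finsetSum_le fun c _ => ?_
    exact (MvPolynomial.totalDegree_mul _ _).trans (Nat.add_le_add (hW j a c) (ih c))

theorem totalDegree_le_of_mem_homogeneous {w : ℕ} {A : Matrix (Fin N) (Fin N) (WAlgebra N p)}
    (hA : A ∈ homogeneous N p w) (a b : Fin N) : (A a b).totalDegree ≤ w := by
  induction hA using Submodule.span_induction with
  | mem A hA =>
    obtain ⟨s, hs, rfl⟩ := hA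
    refine (totalDegree_word_le s a b).trans ?_
    simp only [wordWeight] at hs
    omega
  | zero => simp
  | add A B _ _ hA hB => exact (MvPolynomial.totalDegree_add _ _).trans (max_le hA hB)
  | smul c A _ hA => exact (MvPolynomial.totalDegree_smul_le _ _).trans hA

theorem mem_matrix_of_mem_decomposable {j : ℕ} {S : Subalgebra ℂ (WAlgebra N p)}
    (hS : ∀ s < j, W N p s ∈ (S.matrix : Subalgebra ℂ (Matrix (Fin N) (Fin N) (WAlgebra N p))))
    {A : Matrix (Fin N) (Fin N) (WAlgebra N p)} (hA : A ∈ decomposable N p (j + 1)) :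
    A ∈ (S.matrix : Subalgebra ℂ (Matrix (Fin N) (Fin N) (WAlgebra N p))) := by
  have hle : decomposable N p (j + 1) ≤ Subalgebra.toSubmodule
      (S.matrix : Subalgebra ℂ (Matrix (Fin N) (Fin N) (WAlgebra N p))) := by
    refine Submodule.span_le.mpr ?_
    rintro _ ⟨s, hs, hlen, rfl⟩
    refine Subalgebra.list_prod_mem _ fun y hy => ?_
    obtain ⟨x, hx, rfl⟩ := List.mem_map.mp hy
    have hxs := List.single_le_sum (fun _ _ => Nat.zero_le _) x hx
    simp only [wordWeight] at hs
    exact hS x (by omega)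
  exact hle hA

theorem adjoin_range_eq_top {V : ℕ → Matrix (Fin N) (Fin N) (WAlgebra N p)}
    (hV : ∀ j < p, ∃ c : ℂ, c ≠ 0 ∧ V j - c • W N p j ∈ decomposable N p (j + 1)) :
    Algebra.adjoin ℂ (Set.range fun i : Fin p × Fin N × Fin N => V i.1 i.2.1 i.2.2) = ⊤ := by
  set S := Algebra.adjoin ℂ (Set.range fun i : Fin p × Fin N × Fin N => V i.1 i.2.1 i.2.2)
  have hW (j : ℕ) (hj : j < p) :
      W N p j ∈ (S.matrix : Subalgebra ℂ (Matrix (Fin N) (Fin N) (WAlgebra N p))) := by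
    induction j using Nat.strong_induction_on with
    | _ j ih =>
      obtain ⟨c, hc, hdec⟩ := hV j hj
      have hVj : V j ∈ (S.matrix : Subalgebra ℂ (Matrix (Fin N) (Fin N) (WAlgebra N p))) :=
        fun a b => Algebra.subset_adjoin ⟨(⟨j, hj⟩, a, b), rfl⟩
      have hdiff := mem_matrix_of_mem_decomposable (fun s hs => ih s hs (hs.trans hj)) hdec
      have hsmul := Subalgebra.smul_mem _ (Subalgebra.sub_mem _ hVj hdiff) c⁻¹
      rwa [sub_sub_cancel, inv_smul_smul₀ hc] at hsmul
  rw [eq_top_iff, ← MvPolynomial.adjoin_range_X, Algebra.adjoin_le_iff]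
  rintro _ ⟨⟨j, a, b⟩, rfl⟩
  have h := hW j j.2 a b
  rwa [W_apply_of_lt j.2] at h

theorem algebraicIndependent_of_adjoin_range_eq_top {σ k : Type*} [Finite σ] [Field k]
    {v : σ → MvPolynomial σ k} (hv : Algebra.adjoin k (Set.range v) = ⊤) :
    AlgebraicIndependent k v := by
  have : Algebra.IsAlgebraic (Algebra.adjoin k (Set.range v)) (MvPolynomial σ k) :=
    ⟨fun x => isAlgebraic_algebraMap
      (⟨x, hv ▸ Algebra.mem_top⟩ : Algebra.adjoin k (Set.range v))⟩
  refine (Algebra.IsAlgebraic.isTranscendenceBasis_of_lift_le_trdeg_of_finite k v ?_).1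
  rw [MvPolynomial.trdeg_of_isDomain, Cardinal.lift_lift]

end Triangular

/-! ### The two families -/

section Families

variable {N q : ℕ}

variable (N q) in
/-- The sequence `1, ⁺W̄₀, ⁺W̄₁, …`. -/
noncomputable def plusSeq (k : ℕ) : Matrix (Fin N) (Fin N) (WAlgebra N (q + 1)) :=
  corner N q (q + k)

variable (N q) in
/-- The sequence `1, ⁻W̄₀, ⁻W̄₁, …`. -/
noncomputable def minusSeq : ℕ → Matrix (Fin N) (Fin N) (WAlgebra N (q + 1)) :=
  altInverse (plusSeq N q)

variable (N q) in
/-- The sequence `1, ᵋW̄₀, ᵋW̄₁, …` for the sign `ε`. -/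
noncomputable def signedSeq (ε : ℤˣ) : ℕ → Matrix (Fin N) (Fin N) (WAlgebra N (q + 1)) :=
  if ε = 1 then plusSeq N q else minusSeq N q

theorem signedSeq_one : signedSeq N q 1 = plusSeq N q := if_pos rfl

theorem signedSeq_neg_one : signedSeq N q (-1) = minusSeq N q := if_neg (by decide)

theorem plusSeq_zero : plusSeq N q 0 = 1 := corner_self

theorem plusSeq_mem_homogeneous (k : ℕ) : plusSeq N q k ∈ homogeneous N (q + 1) k := by
  have h := corner_mem_homogeneous (N := N) (q := q) (q + k)
  rwa [Nat.cast_add, add_sub_cancel_left] at h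

theorem altInverse_mem_homogeneous {p : ℕ} {t : ℕ → Matrix (Fin N) (Fin N) (WAlgebra N p)}
    (ht : t 0 = 1) (hmem : ∀ k : ℕ, t k ∈ homogeneous N p k) (k : ℕ) :
    altInverse t k ∈ homogeneous N p k := by
  induction k using Nat.strong_induction_on with
  | _ k ih =>
    cases k with
    | zero => rw [altInverse_zero]; exact one_mem_homogeneous
    | succ n =>
      rw [altInverse_succ ht]
      refine Submodule.sum_mem _ fun x hx => zsmul_mem ?_ _
      rw [Finset.HasAntidiagonal.mem_antidiagonal] at hx
      have h := mul_mem_homogeneous (hmem (x.1 + 1)) (ih x.2 (by omega))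
      rwa [← Nat.cast_add, show x.1 + 1 + x.2 = n + 1 by omega] at h

theorem altInverse_sub_mem_decomposable {p : ℕ} {t : ℕ → Matrix (Fin N) (Fin N) (WAlgebra N p)}
    (ht : t 0 = 1) (hmem : ∀ k : ℕ, t k ∈ homogeneous N p k) (j : ℕ) :
    altInverse t (j + 1) - (-1 : ℤ) ^ j • t (j + 1) ∈ decomposable N p (j + 1) := by
  have hmem_last : (j, 0) ∈ Finset.HasAntidiagonal.antidiagonal j := by simp
  rw [altInverse_succ ht, ← Finset.add_sum_erase _ _ hmem_last, altInverse_zero, mul_one,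
    add_sub_cancel_left]
  refine Submodule.sum_mem _ fun x hx => zsmul_mem ?_ _
  rw [Finset.mem_erase, Finset.HasAntidiagonal.mem_antidiagonal] at hx
  have hpos : 0 < x.2 := Nat.pos_of_ne_zero fun h => hx.1 (Prod.ext (by omega) h)
  have h := mul_mem_decomposable (by omega) (by omega) (hmem (x.1 + 1))
    (altInverse_mem_homogeneous ht hmem x.2)
  rwa [← Nat.cast_add, show x.1 + 1 + x.2 = j + 1 by omega, Nat.cast_succ] at h

theorem signedSeq_mem_homogeneous (ε : ℤˣ) (k : ℕ) :
    signedSeq N q ε k ∈ homogeneous N (q + 1) k := by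
  rcases Int.units_eq_one_or ε with rfl | rfl
  · exact signedSeq_one (N := N) (q := q) ▸ plusSeq_mem_homogeneous k
  · rw [signedSeq_neg_one]
    exact altInverse_mem_homogeneous plusSeq_zero plusSeq_mem_homogeneous k

theorem signedSeq_succ_sub_mem_decomposable (ε : ℤˣ) {j : ℕ} (hj : j < q + 1) :
    ∃ c : ℂ, c ≠ 0 ∧
      signedSeq N q ε (j + 1) - c • W N (q + 1) j ∈ decomposable N (q + 1) (j + 1) := by
  have hplus : plusSeq N q (j + 1) - cornerCoeff q j • W N (q + 1) j ∈
      decomposable N (q + 1) (j + 1) := corner_sub_mem_decomposable j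
  rcases Int.units_eq_one_or ε with rfl | rfl
  · exact ⟨cornerCoeff q j, cornerCoeff_ne_zero hj, signedSeq_one (N := N) (q := q) ▸ hplus⟩
  · refine ⟨((-1 : ℤ) ^ j : ℤ) * cornerCoeff q j,
      mul_ne_zero (by simp) (cornerCoeff_ne_zero hj), ?_⟩
    have hminus := add_mem
      (altInverse_sub_mem_decomposable plusSeq_zero plusSeq_mem_homogeneous j)
      (zsmul_mem hplus ((-1 : ℤ) ^ j))
    rwa [smul_sub, sub_add_sub_cancel, ← Int.cast_smul_eq_zsmul ℂ ((-1 : ℤ) ^ j) (_ • _),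
      smul_smul] at hminus

theorem specialize_minusSeq (k : ℕ) : (specialize N (q + 1)).mapMatrix (minusSeq N q k) =
    (q + 1).choose k • constMatrix N ^ k := by
  have h := map_altInverse ((specialize N (q + 1)).mapMatrix : _ →ₐ[ℂ] _).toRingHom
    (plusSeq_zero (N := N) (q := q)) k
  rw [← altInverse_choose_smul_pow]
  exact h.trans (congrArg (altInverse · k) (funext specialize_corner))

theorem totalDegree_signedSeq {ε : ℤˣ} {j : ℕ} (h : ε = 1 ∨ j < q + 1) (a b : Fin N) :
    (signedSeq N q ε (j + 1) a b).totalDegree = j + 1 := by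
  have hle := totalDegree_le_of_mem_homogeneous
    (signedSeq_mem_homogeneous (N := N) (q := q) ε (j + 1)) a b
  rcases Int.units_eq_one_or ε with rfl | rfl
  · rw [signedSeq_one] at hle ⊢
    exact totalDegree_eq_of_specialize (Nat.choose_pos (by omega)).ne'
      (specialize_corner (j + 1)) hle
  · have hj : j < q + 1 := h.resolve_left (by decide)
    rw [signedSeq_neg_one] at hle ⊢
    exact totalDegree_eq_of_specialize (Nat.choose_pos (by omega)).ne'
      (specialize_minusSeq (j + 1)) hle

theorem minusSeq_one : minusSeq N q 1 = plusSeq N q 1 := altInverse_one plusSeq_zero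

theorem minusSeq_two : minusSeq N q 2 = plusSeq N q 1 * plusSeq N q 1 - plusSeq N q 2 :=
  altInverse_two plusSeq_zero

theorem signedSeq_apply_one (ε : ℤˣ) :
    signedSeq N q ε 1 = ((q + 1 : ℕ) : ℂ) • W N (q + 1) 0 := by
  rcases Int.units_eq_one_or ε with rfl | rfl
  · rw [signedSeq_one]
    exact corner_add_one
  · rw [signedSeq_neg_one, minusSeq_one]
    exact corner_add_one

theorem signedSeq_apply_two (ε : ℤˣ) : signedSeq N q ε 2 =
    (((ε : ℤ) : ℂ) * (((q + 1 : ℕ) : ℂ) * (((q + 1 : ℕ) : ℂ) ^ 2 - 1) / 6)) • W N (q + 1) 1 +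
      (((q + 1 : ℕ) : ℂ) * (((q + 1 : ℕ) : ℂ) + ((ε : ℤ) : ℂ)) / 2) •
        (W N (q + 1) 0 * W N (q + 1) 0) := by
  have hone : plusSeq N q 1 = ((q + 1 : ℕ) : ℂ) • W N (q + 1) 0 := corner_add_one
  have htwo : plusSeq N q 2 = _ := corner_add_two
  rw [cornerCoeff_one, Nat.cast_choose_two] at htwo
  rcases Int.units_eq_one_or ε with rfl | rfl
  · rw [signedSeq_one, htwo]
    push_cast
    module
  · rw [signedSeq_neg_one, minusSeq_two, htwo, hone, smul_mul_smul_comm]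
    push_cast
    module

end Families

/-! ### Poisson brackets of the two families -/

section FamilyBrackets

variable {N p q : ℕ}

theorem hamiltonian_wBracket (f g : WAlgebra N p) :
    hamiltonian (wBracket N p) f g = wBracket N p f g :=
  hamiltonian_biderivation _ f g

theorem wBracket_antisymm (f g : WAlgebra N p) : wBracket N p f g = -wBracket N p g f :=
  biderivation_antisymm (fun _ _ => diracBracket_antisymm _ _) f g

theorem wBracket_sub_left (f g h : WAlgebra N p) :
    wBracket N p (f - g) h = wBracket N p f h - wBracket N p g h := by
  rw [wBracket_antisymm, ← hamiltonian_wBracket, map_sub, hamiltonian_wBracket,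
    hamiltonian_wBracket, neg_sub, wBracket_antisymm h f, wBracket_antisymm h g, sub_neg_eq_add,
    neg_add_eq_sub]

theorem wBracket_mul_apply_left (A B : Matrix (Fin N) (Fin N) (WAlgebra N p)) (a b : Fin N)
    (h : WAlgebra N p) : wBracket N p ((A * B) a b) h =
      ∑ e, (wBracket N p (A a e) h * B e b + A a e * wBracket N p (B e b) h) := by
  rw [wBracket_antisymm, ← hamiltonian_wBracket, ← entrywise_apply, isLeibniz_entrywise,
    Matrix.add_apply, mul_apply, mul_apply, ← Finset.sum_add_distrib, ← Finset.sum_neg_distrib]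
  refine Finset.sum_congr rfl fun e _ => ?_
  rw [entrywise_apply, entrywise_apply, hamiltonian_wBracket, hamiltonian_wBracket,
    wBracket_antisymm h, wBracket_antisymm h]
  ring

theorem mul_single_one_mul_apply {n R : Type*} [Fintype n] [DecidableEq n] [Semiring R]
    (A B : Matrix n n R) (i j k l : n) : (A * single i j (1 : R) * B) k l = A k i * B j l := by
  rw [mul_apply]
  simp only [mul_single_one_apply, ite_mul, zero_mul, Finset.sum_ite_eq, Finset.mem_univ, if_true]

theorem wBracket_plusSeq (n m : ℕ) (a b c d : Fin N) :
    wBracket N (q + 1) (plusSeq N q n a b) (plusSeq N q m c d) =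
      ∑ i ∈ Finset.range n, (plusSeq N q i c b * plusSeq N q (m + (n - 1 - i)) a d -
        plusSeq N q (m + (n - 1 - i)) c b * plusSeq N q i a d) := by
  have hlow : ∑ i ∈ Finset.range (q + n),
      corner N q i a d * corner N q (q + m + (q + n - 1 - i)) c b =
      ∑ i ∈ Finset.range n, plusSeq N q (m + (n - 1 - i)) c b * plusSeq N q i a d := by
    rw [Finset.sum_range_add, Finset.sum_eq_zero, zero_add]
    · refine Finset.sum_congr rfl fun i _ => ?_
      rw [plusSeq, plusSeq, mul_comm, show q + n - 1 - (q + i) = n - 1 - i by omega, add_assoc]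
    · intro i hi
      rw [corner_eq_zero (Finset.mem_range.mp hi), Matrix.zero_apply, zero_mul]
  have hhigh : ∑ i ∈ Finset.range (q + n),
      corner N q (i + (q + m)) a d * corner N q (q + n - 1 - i) c b =
      ∑ i ∈ Finset.range n, plusSeq N q i c b * plusSeq N q (m + (n - 1 - i)) a d := by
    rw [← Finset.sum_range_reflect, Finset.sum_range_add, Finset.sum_eq_zero, zero_add]
    · refine Finset.sum_congr rfl fun i hi => ?_
      rw [Finset.mem_range] at hi
      rw [plusSeq, plusSeq, mul_comm, show q + n - 1 - (q + n - 1 - (q + i)) = q + i by omega,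
        show q + n - 1 - (q + i) + (q + m) = q + (m + (n - 1 - i)) by omega]
    · intro i hi
      rw [Finset.mem_range] at hi
      rw [corner_eq_zero (show q + n - 1 - (q + n - 1 - i) < q by omega), Matrix.zero_apply,
        mul_zero]
  rw [wBracket_antisymm, plusSeq, plusSeq, wBracket_corner, Finset.sum_sub_distrib, hlow, hhigh,
    neg_sub, Finset.sum_sub_distrib]

theorem entrywise_hamiltonian_plusSeq (n m : ℕ) (a b : Fin N) :
    entrywise (hamiltonian (wBracket N (q + 1)) (plusSeq N q n a b)) (plusSeq N q m) =
      ∑ i ∈ Finset.range n,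
        (plusSeq N q i * single b a 1 * plusSeq N q (m + (n - 1 - i)) -
          plusSeq N q (m + (n - 1 - i)) * single b a 1 * plusSeq N q i) := by
  refine Matrix.ext fun c d => ?_
  rw [entrywise_apply, hamiltonian_wBracket, wBracket_plusSeq, Matrix.sum_apply]
  simp only [Matrix.sub_apply, mul_single_one_mul_apply]

theorem entrywise_hamiltonian_plusSeq_one (k : ℕ) (a b : Fin N) :
    entrywise (hamiltonian (wBracket N (q + 1)) (plusSeq N q 1 a b)) (plusSeq N q k) =
      ⁅(single b a 1 : Matrix (Fin N) (Fin N) (WAlgebra N (q + 1))), plusSeq N q k⁆ := by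
  rw [entrywise_hamiltonian_plusSeq, Finset.sum_range_one, plusSeq_zero, one_mul, mul_one,
    Ring.lie_def, Nat.sub_zero, Nat.sub_self, add_zero]

theorem entrywise_hamiltonian_plusSeq_two (k : ℕ) (a b : Fin N) :
    entrywise (hamiltonian (wBracket N (q + 1)) (plusSeq N q 2 a b)) (plusSeq N q k) =
      ⁅(single b a 1 : Matrix (Fin N) (Fin N) (WAlgebra N (q + 1))), plusSeq N q (k + 1)⁆ +
        plusSeq N q 1 * single b a 1 * plusSeq N q k -
        plusSeq N q k * single b a 1 * plusSeq N q 1 := by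
  rw [entrywise_hamiltonian_plusSeq, Finset.sum_range_succ, Finset.sum_range_one, plusSeq_zero,
    one_mul, mul_one, Ring.lie_def]
  simp only [Nat.sub_zero, Nat.sub_self, Nat.add_one_sub_one, add_zero]
  abel

theorem wBracket_plusSeq_one_mul_plusSeq_one (k : ℕ) (a b c d : Fin N) :
    wBracket N (q + 1) ((plusSeq N q 1 * plusSeq N q 1) a b) (plusSeq N q k c d) =
      (single b a 1 * (plusSeq N q 1 * plusSeq N q k) +
        plusSeq N q 1 * single b a 1 * plusSeq N q k -
        plusSeq N q k * plusSeq N q 1 * single b a 1 -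
        plusSeq N q k * single b a 1 * plusSeq N q 1 :
          Matrix (Fin N) (Fin N) (WAlgebra N (q + 1))) c d := by
  have hone (a b : Fin N) : wBracket N (q + 1) (plusSeq N q 1 a b) (plusSeq N q k c d) =
      (if b = c then plusSeq N q k a d else 0) - if a = d then plusSeq N q k c b else 0 := by
    rw [← hamiltonian_wBracket, ← entrywise_apply, entrywise_hamiltonian_plusSeq_one,
      Ring.lie_def, Matrix.sub_apply, single_one_mul_apply, mul_single_one_apply]
  rw [wBracket_mul_apply_left]
  simp only [Matrix.sub_apply, Matrix.add_apply, single_one_mul_apply, mul_single_one_apply,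
    mul_single_one_mul_apply]
  simp only [hone, sub_mul, mul_sub, ite_mul, mul_ite, zero_mul, mul_zero, Finset.sum_add_distrib,
    Finset.sum_sub_distrib, Finset.sum_ite_irrel, Finset.sum_ite_eq', Finset.mem_univ, if_true,
    Finset.sum_const_zero, mul_apply]
  ring

theorem entrywise_hamiltonian_minusSeq_two_plusSeq (k : ℕ) (a b : Fin N) :
    entrywise (hamiltonian (wBracket N (q + 1)) (minusSeq N q 2 a b)) (plusSeq N q k) =
      single b a 1 * (plusSeq N q 1 * plusSeq N q k - plusSeq N q (k + 1)) -
        (plusSeq N q k * plusSeq N q 1 - plusSeq N q (k + 1)) * single b a 1 := by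
  refine Matrix.ext fun c d => ?_
  rw [entrywise_apply, hamiltonian_wBracket, minusSeq_two, Matrix.sub_apply, wBracket_sub_left,
    wBracket_plusSeq_one_mul_plusSeq_one, ← hamiltonian_wBracket _ (plusSeq N q k c d),
    ← entrywise_apply, entrywise_hamiltonian_plusSeq_two, ← Matrix.sub_apply, Ring.lie_def]
  refine congrFun (congrFun ?_ c) d
  noncomm_ring

theorem entrywise_hamiltonian_signedSeq_one (ε : ℤˣ) (k : ℕ) (a b : Fin N) :
    entrywise (hamiltonian (wBracket N (q + 1)) (signedSeq N q ε 1 a b)) (signedSeq N q ε k) =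
      ⁅(single b a 1 : Matrix (Fin N) (Fin N) (WAlgebra N (q + 1))), signedSeq N q ε k⁆ := by
  rcases Int.units_eq_one_or ε with rfl | rfl
  · rw [signedSeq_one, entrywise_hamiltonian_plusSeq_one]
  · rw [signedSeq_neg_one, minusSeq_one]
    exact (isLeibniz_entrywise _).map_altInverse_of_eq_lie plusSeq_zero
      (entrywise_hamiltonian_plusSeq_one · a b) k

theorem entrywise_hamiltonian_signedSeq_two (ε : ℤˣ) (k : ℕ) (a b : Fin N) :
    entrywise (hamiltonian (wBracket N (q + 1)) (signedSeq N q ε 2 a b)) (signedSeq N q ε k) =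
      ⁅(single b a 1 : Matrix (Fin N) (Fin N) (WAlgebra N (q + 1))), signedSeq N q ε (k + 1)⁆ +
        signedSeq N q ε 1 * single b a 1 * signedSeq N q ε k -
        signedSeq N q ε k * single b a 1 * signedSeq N q ε 1 := by
  rcases Int.units_eq_one_or ε with rfl | rfl
  · rw [signedSeq_one, entrywise_hamiltonian_plusSeq_two]
  · rw [signedSeq_neg_one, minusSeq_one]
    exact (isLeibniz_entrywise _).map_altInverse_of_eq plusSeq_zero
      (entrywise_hamiltonian_minusSeq_two_plusSeq · a b) k

theorem lie_single_apply (A : Matrix (Fin N) (Fin N) (WAlgebra N p)) (a b c d : Fin N) :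
    ⁅(single b a 1 : Matrix (Fin N) (Fin N) (WAlgebra N p)), A⁆ c d =
      delta N p c b * A a d - delta N p a d * A c b := by
  simp only [Ring.lie_def, Matrix.sub_apply, single_one_mul_apply, mul_single_one_apply, delta,
    ite_mul, one_mul, zero_mul, eq_comm (a := b)]

theorem wBracket_signedSeq_one (ε : ℤˣ) (k : ℕ) (a b c d : Fin N) :
    wBracket N (q + 1) (signedSeq N q ε 1 a b) (signedSeq N q ε k c d) =
      delta N (q + 1) c b * signedSeq N q ε k a d -
        delta N (q + 1) a d * signedSeq N q ε k c b := by
  rw [← lie_single_apply, ← entrywise_hamiltonian_signedSeq_one, entrywise_apply,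
    hamiltonian_wBracket]

theorem wBracket_signedSeq_two (ε : ℤˣ) (k : ℕ) (a b c d : Fin N) :
    wBracket N (q + 1) (signedSeq N q ε 2 a b) (signedSeq N q ε k c d) =
      delta N (q + 1) c b * signedSeq N q ε (k + 1) a d -
        delta N (q + 1) a d * signedSeq N q ε (k + 1) c b +
        signedSeq N q ε 1 c b * signedSeq N q ε k a d -
        signedSeq N q ε k c b * signedSeq N q ε 1 a d := by
  rw [← hamiltonian_wBracket, ← entrywise_apply, entrywise_hamiltonian_signedSeq_two,
    Matrix.sub_apply, Matrix.add_apply, lie_single_apply, mul_single_one_mul_apply,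
    mul_single_one_mul_apply]

end FamilyBrackets

end FiniteW

theorem mainTheorem6 (N p : ℕ) (hN : 1 ≤ N) (hp : 1 ≤ p) :
    -- the two families, labelled by the sign `ε = ±1`
    ∃ Wbar : ℤˣ → ℕ → Matrix (Fin N) (Fin N) (FiniteW.WAlgebra N p),
      -- the first two generators of each family
      (∀ ε, Wbar ε 0 = (p : ℂ) • FiniteW.W N p 0) ∧
      (∀ ε : ℤˣ, Wbar ε 1 =
        (((ε : ℤ) : ℂ) * ((p : ℂ) * ((p : ℂ) ^ 2 - 1) / 6)) • FiniteW.W N p 1 +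
          ((p : ℂ) * ((p : ℂ) + ((ε : ℤ) : ℂ)) / 2) • (FiniteW.W N p 0 * FiniteW.W N p 0)) ∧
      -- polynomial form in the original generators
      (∃ α : ℤˣ → (n : ℕ) → (Fin n → ℕ) → ℂ, ∀ ε j, Wbar ε j =
        ∑ n ∈ Finset.Icc 1 (j + 1), ∑ s ∈ Finset.Nat.antidiagonalTuple n (j + 1 - n),
          α ε n s • (List.ofFn fun i => FiniteW.W N p (s i)).prod) ∧
      -- degree in the original generators
      (∀ ε j a b, (ε = 1 ∨ j < p) → (Wbar ε j a b).totalDegree = j + 1) ∧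
      -- Poisson brackets with the first two generators
      (∀ ε j a b c d, FiniteW.wBracket N p (Wbar ε 0 a b) (Wbar ε j c d) =
        FiniteW.delta N p c b * Wbar ε j a d - FiniteW.delta N p a d * Wbar ε j c b) ∧
      (∀ ε j a b c d, FiniteW.wBracket N p (Wbar ε 1 a b) (Wbar ε j c d) =
        FiniteW.delta N p c b * Wbar ε (j + 1) a d - FiniteW.delta N p a d * Wbar ε (j + 1) c b +
          Wbar ε 0 c b * Wbar ε j a d - Wbar ε j c b * Wbar ε 0 a d) ∧
      -- the generators with `j < p` form a basis of generators
      (∀ ε, AlgebraicIndependent ℂ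
        (fun i : Fin p × Fin N × Fin N => Wbar ε i.1 i.2.1 i.2.2)) ∧
      (∀ ε, Algebra.adjoin ℂ
        (Set.range fun i : Fin p × Fin N × Fin N => Wbar ε i.1 i.2.1 i.2.2) = ⊤) ∧
      -- the other generators are polynomials in these
      (∀ ε j a b, p ≤ j → Wbar ε j a b ∈ Algebra.adjoin ℂ
        (Set.range fun i : Fin p × Fin N × Fin N => Wbar ε i.1 i.2.1 i.2.2)) := by
  obtain ⟨q, rfl⟩ : ∃ q, p = q + 1 := ⟨p - 1, (Nat.sub_add_cancel hp).symm⟩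
  have hgen (ε : ℤˣ) := FiniteW.adjoin_range_eq_top fun j hj =>
    FiniteW.signedSeq_succ_sub_mem_decomposable (N := N) (q := q) ε hj
  choose α hα using fun ε => FiniteW.exists_forall_eq_sum_words fun j =>
    FiniteW.signedSeq_mem_homogeneous (N := N) (q := q) ε (j + 1)
  exact ⟨fun ε j => FiniteW.signedSeq N q ε (j + 1), FiniteW.signedSeq_apply_one,
    FiniteW.signedSeq_apply_two, ⟨α, hα⟩, fun _ _ a b h => FiniteW.totalDegree_signedSeq h a b,
    fun ε j => FiniteW.wBracket_signedSeq_one ε (j + 1),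
    fun ε j => FiniteW.wBracket_signedSeq_two ε (j + 1),
    fun ε => FiniteW.algebraicIndependent_of_adjoin_range_eq_top (hgen ε), hgen,
    fun ε _ _ _ _ => hgen ε ▸ Algebra.mem_top⟩
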